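/- Let $M$ be a (Hausdorff) complex manifold of dimension $m$ and $(L,h)\to M$ a holomorphic line bundle with a smooth Hermitian metric of positive curvature; give $M$ the Kähler form $\omega=i\partial\bar\partial\varphi$, where $\varphi=-\log\|e\|_h^2$ for a local holomorphic frame $e$ of $L$. Let $X=\{p\in L^*:\|p\|_h=1\}$, $\pi:X\to M$, with the contact form $\alpha=-\mathrm{Re}(i\bar\partial\rho)|_X$, $\rho(p)=-\log\|p\|_h^2$, and Reeb field $R=\partial_\theta$. Let $H\in C^\infty(M,\mathbb R)$ have Hamiltonian vector field $\xi_H$, $dH=\iota_{\xi_H}\omega$, generating a (complete, smooth) flow $g^t$ on $M$, and let $\hat g^t$ be the contact flow on $X$ generated by $\hat\xi_H=\xi_H^h-HR$, where $\xi_H^h$ is the horizontal lift ($\pi_*\xi_H^h=\xi_H$, $\alpha(\xi_H^h)=0$). Let $z\in M$ and $T\in\mathbb R$ with $g^Tz=z$. Let $w=(w_1,\dots,w_m)$ be K-coordinates at $z$, i.e. holomorphic coordinates centred at $z$ with $i\sum_j dw_j\wedge d\bar w_j=\omega|_z$, and let $e_L$ be a K-frame over their domain: a nowhere vanishing holomorphic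 section of $L$ whose potential $\varphi=-\log\|e_L\|_h^2$ has the Taylor expansion $\varphi(w)=|w|^2+\sum_{|J|\ge2,|K|\ge2}a_{JK}w^J\bar w^K$ at $0$ (it is enough that this holds up to an error $O(|w|^{N+1})$ for some $N\ge 2$). In the coordinates $(w;\theta)\mapsto e^{i\theta}e_L^*(w)/\|e_L^*(w)\|_h$ of $X$ write $\hat g^T(w;\theta_w)=(w(T);\theta_w(T))$ and define the holonomy phase $\hat\theta_w(T)=\theta_w(T)-\theta_w\in\mathbb R/2\pi\mathbb Z$ for $w$ near $0$. Then $\hat\theta_w(T)$ is independent of $\theta_w$ and has, near $w=0$, a real-valued branch that is continuous at $w=0$; every such branch is $C^\infty$ at $w=0$ and satisfies $$\hat\theta_w(T)=\hat\theta_0(T)+O(|w|^3)\qquad(w\to0).$$ In particular the Hessian of $w\mapsto\hat\theta_w(T)$ vanishes at $w=0$. Consequently, in the phase $-i\hat\theta_w(T)-\tfrac12\varphi(w(T))$, everything up to second order beyond the constant $-i\hat\theta_0(T)$ is determined by the derivative $Dg^T$ of the first-return map at $w=0$: $$-i\hat\theta_w(T)-\tfrac12\varphi(w(T))=-i\hat\theta_0(T)-\tfrac12|Dg^T_0\,w|^2+O(|w|^3).$$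 -/

import Mathlib

open Set Filter Topology Asymptotics
open scoped Manifold ContDiff InnerProductSpace

noncomputable section

namespace ContactHolonomy

/-- The model space `ℂᵐ`, with its Hermitian norm `|w|² = ∑ |w_j|²`. -/
abbrev Cm (m : ℕ) : Type := EuclideanSpace ℂ (Fin m)

/-- For a real function `f` on a complex vector space, the real `(1,1)`-form `i ∂∂̄ f` at `z`,
evaluated on `(u, v)`. Since `dᶜf = i(∂ - ∂̄)f = df ∘ J` and `i ∂∂̄ f = -½ d dᶜ f`, it equals
`½ (D²f(v, Ju) - D²f(u, Jv))`; for `f = |z|²` it is `i ∑ dz_j ∧ dz̄_j = 2 ∑ dx_j ∧ dy_j`. -/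
def iddbar {m : ℕ} (f : Cm m → ℝ) (z u v : Cm m) : ℝ :=
  (1 / 2) * (fderiv ℝ (fderiv ℝ f) z v (Complex.I • u)
    - fderiv ℝ (fderiv ℝ f) z u (Complex.I • v))

section Bundle

variable {m : ℕ} {M : Type*} [TopologicalSpace M] [ChartedSpace (Cm m) M]
  (L : M → Type*) [TopologicalSpace (Bundle.TotalSpace ℂ L)]
  [∀ x, NormedAddCommGroup (L x)] [∀ x, InnerProductSpace ℂ (L x)]
  [FiberBundle ℂ L] [VectorBundle ℂ ℂ L]

/-- The fibre metric `h` of `L` (given by the norms of the fibres) is smooth. -/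
def IsSmoothHermitianMetric : Prop :=
  ContMDiff (𝓘(ℝ, Cm m).prod 𝓘(ℝ, ℂ)) 𝓘(ℝ, ℝ) ∞
    (fun p : Bundle.TotalSpace ℂ L => ‖p.2‖ ^ 2)

variable {L} in
/-- The local potential `φ = -log ‖e‖²_h` of a local frame `e` of `L`. -/
def potential (e : ∀ x, L x) (x : M) : ℝ := -Real.log (‖e x‖ ^ 2)

/-- The curvature form `ω = i ∂∂̄ φ` of `(L, h)` at `x`, where `φ` is the potential of a local
holomorphic frame near `x`. It does not depend on the frame nor on the holomorphic coordinates;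
here they are the preferred trivialization and the preferred chart at `x`, the latter being the
one through which `TangentSpace _ x` is identified with `ℂᵐ`. -/
def curvatureForm (x : M) (u v : TangentSpace 𝓘(ℝ, Cm m) x) : ℝ :=
  iddbar (fun w : Cm m =>
      potential (fun y => (trivializationAt ℂ L x).symm y 1) ((chartAt (Cm m) x).symm w))
    (chartAt (Cm m) x x) u v

/-- `(L, h)` is positive: `ω(v, Jv) > 0` for `v ≠ 0`. -/
def IsPositive : Prop :=
  ∀ (x : M) (v : Cm m), v ≠ 0 → 0 < curvatureForm (m := m) L x v (Complex.I • v : Cm m)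

/-- `ξ` is the Hamiltonian vector field of `H`: `dH = ι_ξ ω`. -/
def IsHamiltonianVectorField (H : M → ℝ) (ξ : ∀ x : M, TangentSpace 𝓘(ℝ, Cm m) x) : Prop :=
  ∀ (x : M) (v : TangentSpace 𝓘(ℝ, Cm m) x),
    curvatureForm L x (ξ x) v = (mfderiv 𝓘(ℝ, Cm m) 𝓘(ℝ, ℝ) H x v : ℝ)

/-- The smooth flow `g : ℝ × M → M` is generated by `ξ`, that is `gᵗ = exp (t ξ)`. -/
def IsSmoothFlowOf (ξ : ∀ x : M, TangentSpace 𝓘(ℝ, Cm m) x) (g : Flow ℝ M) : Prop :=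
  ContMDiff (𝓘(ℝ, ℝ).prod 𝓘(ℝ, Cm m)) 𝓘(ℝ, Cm m) ∞ (fun p : ℝ × M => g p.1 p.2) ∧
  ∀ x : M, IsMIntegralCurve (I := 𝓘(ℝ, Cm m)) (fun t => g t x) ξ

/-- The fibre of the dual bundle `L*` (with the dual norm of `h`, which is the operator norm). -/
abbrev Dual (x : M) : Type _ := L x →L[ℂ] Bundle.Trivial M ℂ x

/-- The total space of `L*`. -/
abbrev DualTotal : Type _ := Bundle.TotalSpace (ℂ →L[ℂ] ℂ) (Dual L)

variable (m) in
/-- The real model with corners of the total space of `L*`; `J` is multiplication by `i`. -/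
abbrev dualModel := 𝓘(ℝ, Cm m).prod 𝓘(ℝ, ℂ →L[ℂ] ℂ)

/-- The unit circle bundle `X = {p ∈ L* : ‖p‖_h = 1}`. -/
def CircleBundle : Type _ := {p : DualTotal L // ‖p.2‖ = 1}

instance : TopologicalSpace (CircleBundle L) :=
  inferInstanceAs (TopologicalSpace {p : DualTotal L // ‖p.2‖ = 1})

variable {L} in
/-- The projection `π : X → M`. -/
def CircleBundle.base (p : CircleBundle L) : M := p.1.1

/-- The defining function `ρ(p) = -log ‖p‖²_h` of `X` in `L*`. -/
def rho (p : DualTotal L) : ℝ := -Real.log (‖p.2‖ ^ 2)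

/-- `∂̄ρ` at a point of `L*`: `∂̄ρ(v) = ½ (dρ(v) + i dρ(Jv))`. -/
def dbarRho (p : DualTotal L) (v : TangentSpace (dualModel m) p) : ℂ :=
  let dρ : Cm m × (ℂ →L[ℂ] ℂ) → ℝ := fun u => mfderiv (dualModel m) 𝓘(ℝ, ℝ) (rho L) p u
  let u : Cm m × (ℂ →L[ℂ] ℂ) := v
  (1 / 2) * ((dρ u : ℂ) + Complex.I * (dρ (Complex.I • u) : ℂ))

/-- The contact form `α = -Re (i ∂̄ρ)` on `X`, evaluated on a vector tangent to `L*` at a point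
of `X`. In the trivialization `(x, θ) ↦ e^{iθ} e*(x) / ‖e*(x)‖` it is `dθ - ½ dᶜφ`. -/
def contactForm (p : CircleBundle L) (v : TangentSpace (dualModel m) p.1) : ℝ :=
  -(Complex.I * dbarRho (m := m) L p.1 v).re

/-- `v`, tangent to `X` at `p`, is the value at `p` of the contact lift `ξ̂_H = ξ_Hʰ - H R` of
`ξ = ξ_H`. As the horizontal lift satisfies `π_* ξʰ = ξ`, `α(ξʰ) = 0`, and the Reeb field
`π_* R = 0`, `α(R) = 1`, this says `π_* v = ξ` and `α(v) = -H`. -/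
def IsContactLift (H : M → ℝ) (ξ : ∀ x : M, TangentSpace 𝓘(ℝ, Cm m) x)
    (p : CircleBundle L) (v : TangentSpace (dualModel m) p.1) : Prop :=
  (mfderiv (dualModel m) 𝓘(ℝ, Cm m)
      (Bundle.TotalSpace.proj : DualTotal L → M) p.1 v : Cm m) = ξ p.base ∧
  (mfderiv (dualModel m) 𝓘(ℝ, ℝ) (rho L) p.1 v : ℝ) = 0 ∧
  contactForm L p v = -H p.base

/-- `ĝ` is the contact flow on `X`, that is `ĝᵗ = exp (t ξ̂_H)`. -/
def IsContactFlow (H : M → ℝ) (ξ : ∀ x : M, TangentSpace 𝓘(ℝ, Cm m) x)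
    (G : Flow ℝ (CircleBundle L)) : Prop :=
  ∀ (p : CircleBundle L) (t : ℝ), ∃ v : TangentSpace (dualModel m) (G t p).1,
    IsContactLift L H ξ (G t p) v ∧
    HasMFDerivAt 𝓘(ℝ, ℝ) (dualModel m) (fun s => (G s p).1) t
      ((1 : ℝ →L[ℝ] ℝ).smulRight v)

/-- `κ` is a holomorphic chart centred at `z` that is a system of K-coordinates:
`i ∑ dz_j ∧ dz̄_j = ω` at `z`. -/
def IsKCoordinates (z : M) (κ : OpenPartialHomeomorph M (Cm m)) : Prop :=
  κ ∈ IsManifold.maximalAtlas 𝓘(ℂ, Cm m) ω M ∧ z ∈ κ.source ∧ κ z = 0 ∧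
  ∀ u v : TangentSpace 𝓘(ℝ, Cm m) z,
    let a : Cm m := mfderiv 𝓘(ℝ, Cm m) 𝓘(ℝ, Cm m) κ z u
    let b : Cm m := mfderiv 𝓘(ℝ, Cm m) 𝓘(ℝ, Cm m) κ z v
    Complex.I * ∑ j, (a j * (starRingEnd ℂ) (b j) - b j * (starRingEnd ℂ) (a j))
      = ((curvatureForm L z u v : ℝ) : ℂ)

variable {L} in
/-- `e` is a holomorphic frame of `L` over the domain of the K-coordinates `κ` and a K-frame (to
order `N`): the potential `φ = -log ‖e‖²` has at the centre the Taylor expansion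
`φ(w) = |w|² + ∑_{|J| ≥ 2, |K| ≥ 2} a_{JK} w^J w̄^K + O(|w|^{N+1})`.
The variables of the polynomial `P` are the `w_j` (`Sum.inl j`) and the `w̄_j` (`Sum.inr j`). -/
def IsKFrame (κ : OpenPartialHomeomorph M (Cm m)) (e : ∀ x, L x) (N : ℕ) : Prop :=
  ContMDiffOn 𝓘(ℂ, Cm m) (𝓘(ℂ, Cm m).prod 𝓘(ℂ, ℂ)) ω
    (fun x => Bundle.TotalSpace.mk' ℂ x (e x)) κ.source ∧
  (∀ x ∈ κ.source, e x ≠ 0) ∧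
  ∃ P : MvPolynomial (Fin m ⊕ Fin m) ℂ,
    (∀ d ∈ P.support, 2 ≤ ∑ j, d (Sum.inl j) ∧ 2 ≤ ∑ j, d (Sum.inr j)) ∧
    (fun w : Cm m => ((potential e (κ.symm w) : ℝ) : ℂ) - ((‖w‖ ^ 2 : ℝ) : ℂ)
        - MvPolynomial.eval (Sum.elim (fun j => w j) (fun j => (starRingEnd ℂ) (w j))) P)
      =O[𝓝 0] fun w => ‖w‖ ^ (N + 1)

variable {L} in
/-- The fibre coordinate `θ ∈ ℝ/2πℤ` of `p ∈ X` in the frame `e`: since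
`p = e^{iθ} e* / ‖e*‖` means `p(e) = e^{iθ} ‖e‖`, it is the argument of `p(e)`. -/
def fibreAngle (e : ∀ x, L x) (p : CircleBundle L) : Real.Angle :=
  ((Complex.arg (p.1.2 (e p.base)) : ℝ) : Real.Angle)

variable {L} in
/-- Near the centre, `Θ` is a continuous real-valued branch of the holonomy phase
`w ↦ θ̂_w(T) = θ_w(T) - θ_w ∈ ℝ/2πℤ`, where `ĝᵀ(w; θ_w) = (w(T); θ_w(T))` in the coordinates
of `X` given by `κ` and `e`. In particular the phase is the same for all points of `X` over the
point with coordinate `w`. -/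
def IsHolonomyPhase (κ : OpenPartialHomeomorph M (Cm m)) (e : ∀ x, L x)
    (G : Flow ℝ (CircleBundle L)) (T : ℝ) (Θ : Cm m → ℝ) : Prop :=
  ContinuousAt Θ 0 ∧
  ∀ᶠ w in 𝓝 (0 : Cm m), ∀ p : CircleBundle L, p.base = κ.symm w →
    fibreAngle e (G T p) - fibreAngle e p = ((Θ w : ℝ) : Real.Angle)

end Bundle

/-- The first-return map `gᵀ` in the coordinates `κ`. -/
def returnMap {m : ℕ} {M : Type*} [TopologicalSpace M]
    (κ : OpenPartialHomeomorph M (Cm m)) (g : Flow ℝ M) (T : ℝ) (w : Cm m) : Cm m :=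
  κ (g T (κ.symm w))

end ContactHolonomy

end

/-! Let `Z(p) = p(s)` be the fibre coordinate on `L*` given by a holomorphic frame `s` with
potential `φ`. The conditions `dρ = 0` and `α = -H` on the contact lift are the real and imaginary
parts of one equation: along the contact flow `Z' = -(iH + ∂φ(ξ)) Z`. Hence `ĝᵗ` multiplies the
fibre coordinate by `U = exp(-∫ (iH + ∂φ(ξ)) dt)`, which depends on the base point only, and the
holonomy phase is `arg U`.

The heart of the matter is the derivative of `U` in the initial point. As `d∂φ = iω` and `ι_ξ ω =
dH`, Cartan's formula reads `L_ξ ∂φ = d(iH + ∂φ(ξ))`, so `d log U = ∂φ_e - (gᵗ)^*∂φ_s`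
(`hasFDerivAt_integral_lagrangian`). This is valid while the orbit stays where `s` is defined.
Replacing `s` by `f s` multiplies `U` by `f ∘ gᵗ` and subtracts `df/f` from `∂φ_s`, so the formula
does not depend on the frame, and the set of times at which it holds is open and closed
(`hasTransport`).

At time `T` the frame is `e` at both ends and `dΘ = Im(∂φ - γ^*∂φ)`, with `γ` the first-return map.
In a K-frame `φ = |w|² + O(|w|³)`, so `∂φ` vanishes at `0 = γ(0)` and `DΘ(0) = 0`. With `Q = D²φ(0)`
and `A = Dγ(0)`, one more derivative gives `D²Θ(u, v) = -½ (Q(u, iv) - Q(Au, iAv))`. This is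
alternating in `u, v`, whereas a Hessian is symmetric; so it is zero (`fderiv_phase_eq_zero`). That
`A` is symplectic needs no separate proof: the existence of the primitive `Θ` contains it. Taylor's
formula then bounds the phase, and the expansion of `φ ∘ γ` supplies the last claim. -/

noncomputable section

namespace ContactHolonomy

/-! ### Complex linear parts, Levi forms, the variation of the action integral, and jets. -/

section Calculus

variable {E : Type*} [NormedAddCommGroup E] [NormedSpace ℂ E] [NormedSpace ℝ E]
  [IsScalarTower ℝ ℂ E]
  {F : Type*} [NormedAddCommGroup F] [NormedSpace ℂ F] [NormedSpace ℝ F] [IsScalarTower ℝ ℂ F]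
  {G : Type*} [NormedAddCommGroup G] [NormedSpace ℝ G]
  {V : Type*} [NormedAddCommGroup V] [NormedSpace ℝ V]

variable (E) in
/-- Multiplication by `i`, as a real linear map. -/
def mulI : E →L[ℝ] E := (Complex.I • ContinuousLinearMap.id ℂ E).restrictScalars ℝ

@[simp] lemma mulI_apply (v : E) : mulI E v = Complex.I • v := rfl

variable (E) in
/-- The complex linear part `v ↦ ½ (ℓ(v) - i ℓ(iv))` of a real linear form, so that
`∂f = delPart (df)`. -/
def delPart : (E →L[ℝ] ℝ) →L[ℝ] (E →L[ℝ] ℂ) :=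
  (1 / 2 : ℝ) • (ContinuousLinearMap.compL ℝ E ℝ ℂ Complex.ofRealCLM
    - (ContinuousLinearMap.compL ℝ E ℝ ℂ (Complex.I • Complex.ofRealCLM)).comp
        ((ContinuousLinearMap.compL ℝ E E ℝ).flip (mulI E)))

/-- The sum is left unevaluated because `fderiv_right` with `m := 1` asks for `1 + 1 ≤ n`. -/
lemma one_add_one_le_infty : (1 + 1 : WithTop ℕ∞) ≤ ∞ := by
  rw [one_add_one_eq_two]; exact WithTop.coe_le_coe.2 le_top

lemma delPart_apply (l : E →L[ℝ] ℝ) (v : E) :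
    delPart E l v = (1 / 2) * ((l v : ℂ) - Complex.I * (l (Complex.I • v) : ℂ)) := by
  simp [delPart]

lemma delPart_comp (l : F →L[ℝ] ℝ) (A : E →L[ℝ] F)
    (hA : ∀ v, A (Complex.I • v) = Complex.I • A v) :
    delPart E (l.comp A) = (delPart F l).comp A := by
  ext v
  simp [delPart_apply, hA]

/-- Applied to `log |f|² = 2 Re log f`, this yields `∂ log |f|² = df / f`. -/
lemma delPart_two_re (A : E →L[ℝ] ℂ) (hA : ∀ v, A (Complex.I • v) = Complex.I • A v) :
    delPart E ((2 : ℝ) • Complex.reCLM.comp A) = A := by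
  ext v
  apply Complex.ext <;> simp [delPart_apply, hA]

/-- The second derivative of a composition. -/
lemma fderiv_fderiv_comp {V' : Type*} [NormedAddCommGroup V'] [NormedSpace ℝ V']
    {f : V → G} {τ : V' → V} {c : V'}
    (hf : ContDiffAt ℝ 2 f (τ c)) (hτ : ContDiffAt ℝ 2 τ c) (u v : V') :
    fderiv ℝ (fderiv ℝ (f ∘ τ)) c u v =
      fderiv ℝ (fderiv ℝ f) (τ c) (fderiv ℝ τ c u) (fderiv ℝ τ c v)
        + fderiv ℝ f (τ c) (fderiv ℝ (fderiv ℝ τ) c u v) := by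
  have h1 : ∀ᶠ x in 𝓝 c, fderiv ℝ (f ∘ τ) x = (fderiv ℝ f (τ x)).comp (fderiv ℝ τ x) := by
    have e1 : ∀ᶠ x in 𝓝 c, ContDiffAt ℝ 2 τ x := hτ.eventually (by simp)
    have e2 : ∀ᶠ x in 𝓝 c, ContDiffAt ℝ 2 f (τ x) :=
      hτ.continuousAt.eventually (hf.eventually (by simp))
    filter_upwards [e1, e2] with x hx1 hx2
    exact fderiv_comp x (ContDiffAt.differentiableAt hx2 (by simp))
      (ContDiffAt.differentiableAt hx1 (by simp))
  rw [Filter.EventuallyEq.fderiv_eq h1]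
  have d1 : HasFDerivAt (fderiv ℝ τ) (fderiv ℝ (fderiv ℝ τ) c) c :=
    ((hτ.fderiv_right (m := 1) (by norm_num)).differentiableAt (by simp)).hasFDerivAt
  have d2 : HasFDerivAt (fderiv ℝ f) (fderiv ℝ (fderiv ℝ f) (τ c)) (τ c) :=
    ((hf.fderiv_right (m := 1) (by norm_num)).differentiableAt (by simp)).hasFDerivAt
  have d3 : HasFDerivAt τ (fderiv ℝ τ c) c := (hτ.differentiableAt (by simp)).hasFDerivAt
  have := ((d2.comp c d3).clm_comp d1).fderiv
  simp only [Function.comp_def] at this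
  rw [this]
  simp [add_comm]

lemma fderiv_smul_I {τ : E → F} {c : E} (h : DifferentiableAt ℂ τ c) (v : E) :
    fderiv ℝ τ c (Complex.I • v) = Complex.I • fderiv ℝ τ c v := by
  rw [h.fderiv_restrictScalars ℝ]
  simp

/-- Obtained by differentiating `Dτ(x)(iv) = i Dτ(x)v` with respect to `x`. -/
lemma fderiv_fderiv_smul_I {τ : E → F} {c : E} (h : ContDiffAt ℂ 2 τ c) (u v : E) :
    fderiv ℝ (fderiv ℝ τ) c u (Complex.I • v) = Complex.I • fderiv ℝ (fderiv ℝ τ) c u v := by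
  have hR : ContDiffAt ℝ 2 τ c := h.restrict_scalars ℝ
  have d : DifferentiableAt ℝ (fderiv ℝ τ) c :=
    (hR.fderiv_right (m := 1) (by norm_num)).differentiableAt (by simp)
  have e : (fun x => fderiv ℝ τ x (Complex.I • v)) =ᶠ[𝓝 c]
      fun x => mulI F (fderiv ℝ τ x v) := by
    filter_upwards [h.eventually (by simp)] with x hx
    simp [fderiv_smul_I (hx.differentiableAt (by simp))]
  have h1 : HasFDerivAt (fun x => fderiv ℝ τ x (Complex.I • v))
      ((fderiv ℝ (fderiv ℝ τ) c).flip (Complex.I • v)) c :=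
    by simpa using d.hasFDerivAt.clm_apply (hasFDerivAt_const (Complex.I • v) c)
  have h2 : HasFDerivAt (fun x => mulI F (fderiv ℝ τ x v))
      ((mulI F).comp ((fderiv ℝ (fderiv ℝ τ) c).flip v)) c := by
    have : HasFDerivAt (fun x => fderiv ℝ τ x v) ((fderiv ℝ (fderiv ℝ τ) c).flip v) c := by
      simpa using d.hasFDerivAt.clm_apply (hasFDerivAt_const v c)
    exact (mulI F).hasFDerivAt.comp c this
  have := (h1.congr_of_eventuallyEq e.symm).unique h2
  simpa using congrArg (fun A => A u) this

/-- Under a holomorphic map the Levi form is the pull back of the Levi form. -/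
lemma levi_comp {φ : F → ℝ} {τ : E → F} {c : E}
    (hφ : ContDiffAt ℝ 2 φ (τ c)) (hτ : ContDiffAt ℂ 2 τ c) (u v : E) :
    fderiv ℝ (fderiv ℝ (φ ∘ τ)) c v (Complex.I • u)
        - fderiv ℝ (fderiv ℝ (φ ∘ τ)) c u (Complex.I • v)
      = fderiv ℝ (fderiv ℝ φ) (τ c) (fderiv ℝ τ c v) (Complex.I • fderiv ℝ τ c u)
        - fderiv ℝ (fderiv ℝ φ) (τ c) (fderiv ℝ τ c u) (Complex.I • fderiv ℝ τ c v) := by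
  have hR : ContDiffAt ℝ 2 τ c := hτ.restrict_scalars ℝ
  rw [fderiv_fderiv_comp hφ hR, fderiv_fderiv_comp hφ hR, fderiv_fderiv_smul_I hτ,
    fderiv_fderiv_smul_I hτ, fderiv_smul_I (hτ.differentiableAt (by simp)),
    fderiv_smul_I (hτ.differentiableAt (by simp)),
    (hR.isSymmSndFDerivAt (by simp)).eq u v]
  ring

/-- Dividing by `f c` puts the argument of the logarithm near `1`, away from the branch cut, so `log
|f|²` becomes locally the real part of a holomorphic function plus a constant. -/
lemma log_norm_sq_eventuallyEq {X : Type*} [TopologicalSpace X] {f : X → ℂ} {c : X} (hf : ContinuousAt f c) (h0 : f c ≠ 0) :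
    (fun x => Real.log (‖f x‖ ^ 2)) =ᶠ[𝓝 c]
      fun x => ((2 : ℝ) • Complex.reCLM) (Complex.log (f x / f c)) + Real.log (‖f c‖ ^ 2) := by
  filter_upwards [hf.eventually_ne h0] with x hx
  have h1 : Real.log ‖f x / f c‖ = Real.log ‖f x‖ - Real.log ‖f c‖ := by
    rw [norm_div, Real.log_div (by simpa using hx) (by simpa using h0)]
  simp only [smul_apply, Complex.reCLM_apply, Complex.log_re, h1,
    Real.log_pow, smul_eq_mul]
  push_cast; ring

lemma contDiffAt_log_div {X : Type*} [NormedAddCommGroup X] [NormedSpace ℂ X]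
    {f : X → ℂ} {c : X} {n : WithTop ℕ∞} (hf : ContDiffAt ℂ n f c)
    (h0 : f c ≠ 0) : ContDiffAt ℂ n (fun x => Complex.log (f x / f c)) c :=
  ContDiffAt.comp c (f := fun x => f x / f c) (Complex.contDiffAt_log (by simp [h0]))
    (hf.div_const _)

/-- `log |f|²` is pluriharmonic: up to a constant it is the linear function `2 Re` composed with a
holomorphic map. This makes the curvature independent of the frame. -/
lemma levi_log_norm_sq {f : E → ℂ} {c : E} (hf : ContDiffAt ℂ 2 f c) (h0 : f c ≠ 0) (u v : E) :
    fderiv ℝ (fderiv ℝ (fun x => Real.log (‖f x‖ ^ 2))) c v (Complex.I • u)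
      - fderiv ℝ (fderiv ℝ (fun x => Real.log (‖f x‖ ^ 2))) c u (Complex.I • v) = 0 := by
  have e := log_norm_sq_eventuallyEq hf.continuousAt h0
  have e2 := e.fderiv (𝕜 := ℝ)
  rw [e2.fderiv_eq]
  have e3 : fderiv ℝ (fun x => ((2 : ℝ) • Complex.reCLM) (Complex.log (f x / f c))
      + Real.log (‖f c‖ ^ 2)) =
      fderiv ℝ (((2 : ℝ) • Complex.reCLM) ∘ fun x => Complex.log (f x / f c)) := by
    ext1 x; rw [fderiv_add_const]; rfl
  rw [e3, levi_comp (ContinuousLinearMap.contDiff _).contDiffAt (contDiffAt_log_div hf h0)]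
  have : fderiv ℝ (fderiv ℝ ((2 : ℝ) • Complex.reCLM)) (Complex.log (f c / f c)) = 0 := by
    have : fderiv ℝ ((2 : ℝ) • Complex.reCLM : ℂ →L[ℝ] ℝ) = fun _ => (2 : ℝ) • Complex.reCLM := by
      ext1 x; exact ContinuousLinearMap.fderiv _
    rw [this]; simp
  rw [this]; simp

lemma hasFDerivAt_log_norm_sq {f : V → ℂ} {c : V} {f' : V →L[ℝ] ℂ} (hf : HasFDerivAt f f' c)
    (h0 : f c ≠ 0) : HasFDerivAt (fun x => Real.log (‖f x‖ ^ 2))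
      ((2 : ℝ) • Complex.reCLM.comp ((f c)⁻¹ • f')) c := by
  have h1 : HasFDerivAt (fun x => ((2 : ℝ) • Complex.reCLM) (Complex.log (f x / f c))
      + Real.log (‖f c‖ ^ 2)) ((2 : ℝ) • Complex.reCLM.comp ((f c)⁻¹ • f')) c := by
    have a1 : HasFDerivAt (fun x => f x / f c) ((f c)⁻¹ • f') c := by
      simpa only [div_eq_inv_mul] using hf.const_mul (f c)⁻¹
    have a2 := (Complex.hasStrictFDerivAt_log_real (x := f c / f c)
      (by simp [h0])).hasFDerivAt.comp c a1
    have a3 := ((((2 : ℝ) • Complex.reCLM).hasFDerivAt.comp c a2).add_const (Real.log (‖f c‖ ^ 2)))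
    refine a3.congr_fderiv ?_
    ext v; simp [h0]
  exact h1.congr_of_eventuallyEq <| log_norm_sq_eventuallyEq hf.continuousAt h0

/-- Differentiation under the integral sign, when the derivative of the integrand in the parameter
is itself a derivative in the variable of integration. -/
lemma hasFDerivAt_intervalIntegral_of_hasDerivAt {a : ℝ × V → ℂ} {B : ℝ × V → V →L[ℝ] ℂ}
    {s t : ℝ} {w₀ : V}
    (ha : ∀ τ ∈ uIcc s t, ContDiffAt ℝ 1 a (τ, w₀))
    (hB : ∀ τ ∈ uIcc s t, HasDerivAt (fun r => B (r, w₀))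
      ((fderiv ℝ a (τ, w₀)).comp (ContinuousLinearMap.inr ℝ ℝ V)) τ) :
    HasFDerivAt (fun w => ∫ τ in s..t, a (τ, w)) (B (t, w₀) - B (s, w₀)) w₀ := by
  have hc : ∀ τ ∈ uIcc s t, ContinuousAt (fderiv ℝ a) (τ, w₀) := fun τ hτ =>
    ((ha τ hτ).fderiv_right (m := 0) (by norm_num)).continuousAt
  have hcurve : ∀ w : V, Continuous fun τ : ℝ => (τ, w) := fun w => by fun_prop
  have hcF : ContinuousOn (fun τ => (fderiv ℝ a (τ, w₀)).comp (ContinuousLinearMap.inr ℝ ℝ V))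
      (uIcc s t) := by
    intro τ hτ
    have : ContinuousAt (fun τ => fderiv ℝ a (τ, w₀)) τ :=
      ContinuousAt.comp (f := fun τ : ℝ => (τ, w₀)) (hc τ hτ) (hcurve w₀).continuousAt
    exact (this.clm_comp continuousAt_const).continuousWithinAt
  obtain ⟨C, hC⟩ : ∃ C, ∀ τ ∈ uIcc s t, ‖fderiv ℝ a (τ, w₀)‖ ≤ C :=
    isCompact_uIcc.exists_bound_of_continuousOn fun τ hτ =>
      (ContinuousAt.comp (f := fun τ : ℝ => (τ, w₀)) (hc τ hτ)
        (hcurve w₀).continuousAt).continuousWithinAt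
  -- Compactness of the time interval gives one neighbourhood of `w₀` on which the bound `C + 1`
  -- holds for all times; this is the domination needed below.
  have hev : ∀ᶠ w in 𝓝 w₀, ∀ τ ∈ uIcc s t,
      ContDiffAt ℝ 1 a (τ, w) ∧ ‖fderiv ℝ a (τ, w)‖ ≤ C + 1 := by
    refine isCompact_uIcc.eventually_forall_of_forall_eventually fun τ hτ => ?_
    have h1 : ∀ᶠ q in 𝓝 (τ, w₀), ContDiffAt ℝ 1 a q ∧ ‖fderiv ℝ a q‖ ≤ C + 1 := by
      refine ((ha τ hτ).eventually (by simp)).and ?_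
      have := (hc τ hτ).norm.eventually_lt_const (u := C + 1) (by linarith [hC τ hτ])
      filter_upwards [this] with q hq using hq.le
    exact (continuous_swap.tendsto (w₀, τ)).eventually h1
  have hmono : uIoc s t ⊆ uIcc s t := uIoc_subset_uIcc
  have hca : ∀ w, (∀ τ ∈ uIcc s t, ContDiffAt ℝ 1 a (τ, w)) →
      ContinuousOn (fun τ => a (τ, w)) (uIcc s t) := fun w hw τ hτ =>
    (ContinuousAt.comp (f := fun τ : ℝ => (τ, w)) (hw τ hτ).continuousAt
        (hcurve w).continuousAt).continuousWithinAt
  have hder := intervalIntegral.hasFDerivAt_integral_of_dominated_of_fderiv_le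
    (𝕜 := ℝ) (μ := MeasureTheory.volume)
    (F := fun w τ => a (τ, w)) (a := s) (b := t) (bound := fun _ => (C + 1) * 1)
    (F' := fun w τ => (fderiv ℝ a (τ, w)).comp (ContinuousLinearMap.inr ℝ ℝ V))
    (x₀ := w₀) hev
    (by
      filter_upwards [hev] with w hw
      exact ((hca w fun τ hτ => (hw τ hτ).1).mono hmono).aestronglyMeasurable
        measurableSet_uIoc)
    ((hca w₀ ha).intervalIntegrable)
    ((hcF.mono hmono).aestronglyMeasurable measurableSet_uIoc)
    (by
      refine Eventually.of_forall fun τ hτ w hw => ?_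
      have := (hw τ (hmono hτ)).2
      refine (ContinuousLinearMap.opNorm_comp_le _ _).trans ?_
      gcongr
      · exact (norm_nonneg _).trans this
      · exact ContinuousLinearMap.norm_inr_le_one ℝ ℝ V)
    (by simp)
    (by
      refine Eventually.of_forall fun τ hτ w hw => ?_
      have h1 := ((hw τ (hmono hτ)).1.differentiableAt (by simp)).hasFDerivAt
      exact h1.comp w (hasFDerivAt_prodMk_right τ w))
  rwa [intervalIntegral.integral_eq_sub_of_hasDerivAt hB hcF.intervalIntegrable] at hder

/-- If the Hamiltonian identity `ι_{∂ₜγ} i∂∂̄φ = dh` holds along `γ`, then the parameter derivative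
of `∫ (i h(γ) + ∂φ(∂ₜγ)) dt` is the increment of `γₜ^*(∂φ)`. -/
lemma hasFDerivAt_integral_lagrangian {φ h : E → ℝ} {γ : ℝ × V → E} {s t : ℝ} {w₀ : V}
    (hγ : ∀ τ ∈ uIcc s t, ContDiffAt ℝ ∞ γ (τ, w₀))
    (hφ : ∀ τ ∈ uIcc s t, ContDiffAt ℝ ∞ φ (γ (τ, w₀)))
    (hh : ∀ τ ∈ uIcc s t, ContDiffAt ℝ ∞ h (γ (τ, w₀)))
    (hham : ∀ τ ∈ uIcc s t, ∀ u : E,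
      fderiv ℝ (fderiv ℝ φ) (γ (τ, w₀)) u (Complex.I • fderiv ℝ γ (τ, w₀) (1, 0))
        - fderiv ℝ (fderiv ℝ φ) (γ (τ, w₀)) (fderiv ℝ γ (τ, w₀) (1, 0)) (Complex.I • u)
      = 2 * fderiv ℝ h (γ (τ, w₀)) u) :
    HasFDerivAt (fun w => ∫ τ in s..t, (Complex.I * (h (γ (τ, w)) : ℂ)
        + delPart E (fderiv ℝ φ (γ (τ, w))) (fderiv ℝ γ (τ, w) (1, 0))))
      ((delPart E (fderiv ℝ φ (γ (t, w₀)))).comp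
          ((fderiv ℝ γ (t, w₀)).comp (ContinuousLinearMap.inr ℝ ℝ V))
        - (delPart E (fderiv ℝ φ (γ (s, w₀)))).comp
          ((fderiv ℝ γ (s, w₀)).comp (ContinuousLinearMap.inr ℝ ℝ V))) w₀ := by
  refine hasFDerivAt_intervalIntegral_of_hasDerivAt
    (a := fun q => Complex.I * (h (γ q) : ℂ) + delPart E (fderiv ℝ φ (γ q)) (fderiv ℝ γ q (1, 0)))
    (B := fun q => (delPart E (fderiv ℝ φ (γ q))).comp
      ((fderiv ℝ γ q).comp (ContinuousLinearMap.inr ℝ ℝ V))) ?_ ?_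
  · intro τ hτ
    have h1 : ContDiffAt ℝ 1 (fun q => (h (γ q) : ℂ)) (τ, w₀) :=
      Complex.ofRealCLM.contDiff.contDiffAt.comp _
        (((hh τ hτ).comp _ (hγ τ hτ)).of_le (by simp))
    have h2 : ContDiffAt ℝ 1 (fun q => delPart E (fderiv ℝ φ (γ q))) (τ, w₀) :=
      (delPart E).contDiff.contDiffAt.comp _
        ((((hφ τ hτ).fderiv_right (m := 1) one_add_one_le_infty).comp _ ((hγ τ hτ).of_le (by simp))))
    have h3 : ContDiffAt ℝ 1 (fun q => fderiv ℝ γ q (1, 0)) (τ, w₀) :=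
      ((hγ τ hτ).fderiv_right (m := 1) one_add_one_le_infty).clm_apply contDiffAt_const
    exact (contDiffAt_const.mul h1).add (h2.clm_apply h3)
  · intro τ hτ
    set q : ℝ × V := (τ, w₀)
    have g1 : HasFDerivAt γ (fderiv ℝ γ q) q := ((hγ τ hτ).differentiableAt (by simp)).hasFDerivAt
    have g2 : HasFDerivAt (fderiv ℝ γ) (fderiv ℝ (fderiv ℝ γ) q) q :=
      (((hγ τ hτ).fderiv_right (m := 1) one_add_one_le_infty).differentiableAt (by simp)).hasFDerivAt
    have p2 : HasFDerivAt (fderiv ℝ φ) (fderiv ℝ (fderiv ℝ φ) (γ q)) (γ q) :=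
      (((hφ τ hτ).fderiv_right (m := 1) one_add_one_le_infty).differentiableAt (by simp)).hasFDerivAt
    have h1 : HasFDerivAt h (fderiv ℝ h (γ q)) (γ q) :=
      ((hh τ hτ).differentiableAt (by simp)).hasFDerivAt
    have b1 : HasFDerivAt (fun q => delPart E (fderiv ℝ φ (γ q)))
        ((delPart E).comp ((fderiv ℝ (fderiv ℝ φ) (γ q)).comp (fderiv ℝ γ q))) q :=
      (delPart E).hasFDerivAt.comp q (p2.comp q g1)
    have k1 : HasFDerivAt (fun q => (h (γ q) : ℂ))
        (Complex.ofRealCLM.comp ((fderiv ℝ h (γ q)).comp (fderiv ℝ γ q))) q :=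
      Complex.ofRealCLM.hasFDerivAt.comp q (h1.comp q g1)
    have a1 := ((k1.const_mul Complex.I).add
      (b1.clm_apply (g2.clm_apply (hasFDerivAt_const ((1 : ℝ), (0 : V)) q)))).fderiv
    have c1 : HasDerivAt (fun r : ℝ => ((r, w₀) : ℝ × V)) (1, 0) τ :=
      (hasDerivAt_id τ).prodMk (hasDerivAt_const τ w₀)
    have B1 := (b1.clm_comp (g2.clm_comp (hasFDerivAt_const
      (ContinuousLinearMap.inr ℝ ℝ V) q))).comp_hasDerivAt τ c1
    refine B1.congr_deriv ?_
    erw [a1]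
    ext v
    -- Symmetry of `D²γ` cancels the terms containing `∂φ`. Those containing `D²φ` leave `-i` times
    -- half the Levi form, that is `-i dh`, which cancels the derivative of `i h`.
    have hs := (((hγ τ hτ).of_le one_add_one_le_infty).isSymmSndFDerivAt (by simp [one_add_one_eq_two])).eq (0, v) (1, 0)
    have hm := hham τ hτ (fderiv ℝ γ q (0, v))
    have hsφ := (((hφ τ hτ).of_le one_add_one_le_infty).isSymmSndFDerivAt (by simp [one_add_one_eq_two])).eq
      (fderiv ℝ γ q (0, v)) (fderiv ℝ γ q (1, 0))
    have hm' := congrArg (fun x : ℝ => (x : ℂ)) hm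
    push_cast at hm'
    have hsφ' := congrArg (fun x : ℝ => (x : ℂ)) hsφ
    simp only [ContinuousLinearMap.comp_apply, add_apply, delPart_apply, smul_apply,
      ContinuousLinearMap.flip_apply, ContinuousLinearMap.compL_apply,
      ContinuousLinearMap.inr_apply, zero_add, Complex.ofRealCLM_apply, smul_eq_mul,
      ContinuousLinearMap.comp_zero]
    change _ = fderiv ℝ (fderiv ℝ γ) q (1, 0) (0, v) at hs
    rw [show fderiv ℝ (fderiv ℝ γ) q (0, v) (1, 0) = _ from hs]
    linear_combination (Complex.I / 2) * hm' - (1 / 2) * hsφ'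

/-- A function whose derivative is `O(|x|^k)` is constant up to `O(|x|^(k+1))`. -/
lemma isBigO_sub_of_isBigO_fderiv {f : V → G} {k : ℕ}
    (hd : ∀ᶠ x in 𝓝 0, DifferentiableAt ℝ f x)
    (hO : fderiv ℝ f =O[𝓝 0] fun x => ‖x‖ ^ k) :
    (fun x => f x - f 0) =O[𝓝 0] fun x => ‖x‖ ^ (k + 1) := by
  obtain ⟨C, hC⟩ := hO.bound
  obtain ⟨r, hr, hball⟩ := Metric.eventually_nhds_iff_ball.1 (hd.and hC)
  refine IsBigO.of_bound |C| ?_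
  filter_upwards [Metric.ball_mem_nhds (0 : V) hr] with x hx
  have hx' : ‖x‖ < r := by simpa using hx
  have hC0 : ∀ y ∈ Metric.closedBall (0 : V) ‖x‖, ‖fderiv ℝ f y‖ ≤ |C| * ‖x‖ ^ k := by
    intro y hy
    have hy' : ‖y‖ ≤ ‖x‖ := by simpa using hy
    have := (hball y (by simpa using hy'.trans_lt hx')).2
    refine this.trans ?_
    rw [norm_pow, norm_norm]
    have := le_abs_self C
    gcongr
  have key := (convex_closedBall (0 : V) ‖x‖).norm_image_sub_le_of_norm_fderiv_le (𝕜 := ℝ)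
    (f := f) (fun y hy => (hball y (by
      have hy' : ‖y‖ ≤ ‖x‖ := by simpa using hy
      simpa using hy'.trans_lt hx')).1) hC0
    (x := 0) (y := x) (by simp) (by simp)
  rw [norm_pow, norm_norm]
  refine key.trans (le_of_eq ?_)
  simp; ring

/-- `D²f` is `O(|x|)` because it is differentiable and vanishes at `0`; two applications of the mean
value inequality raise the order to three. -/
lemma isBigO_cube_of_fderiv_eq_zero {f : V → G} (hf : ContDiffAt ℝ ∞ f 0)
    (h1 : fderiv ℝ f 0 = 0) (h2 : fderiv ℝ (fderiv ℝ f) 0 = 0) :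
    (fun x => f x - f 0) =O[𝓝 0] fun x => ‖x‖ ^ 3 := by
  have hle : ∀ n : ℕ, ((n : ℕ∞) : WithTop ℕ∞) ≤ ∞ := fun n => WithTop.coe_le_coe.2 le_top
  have c1 : ContDiffAt ℝ 2 (fderiv ℝ f) 0 := hf.fderiv_right (hle 3)
  have c2 : ContDiffAt ℝ 1 (fderiv ℝ (fderiv ℝ f)) 0 := c1.fderiv_right (by norm_num)
  have d3 : (fderiv ℝ (fderiv ℝ f)) =O[𝓝 0] fun x => ‖x‖ ^ 1 := by
    simpa [h2] using (c2.differentiableAt (by simp)).isBigO_sub.norm_right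
  have d2 : (fderiv ℝ f) =O[𝓝 0] fun x => ‖x‖ ^ 2 := by
    simpa [h1] using isBigO_sub_of_isBigO_fderiv
      ((c1.eventually (by simp)).mono fun x hx => hx.differentiableAt (by simp)) d3
  exact isBigO_sub_of_isBigO_fderiv
    (((hf.of_le one_add_one_le_infty).eventually (by simp [one_add_one_eq_two])).mono
      fun x hx => hx.differentiableAt (by simp)) d2

lemma eq_zero_of_isBigO_cube {a b : ℝ}
    (h : (fun t : ℝ => t * a + t ^ 2 * b) =O[𝓝 0] fun t => ‖t‖ ^ 3) : a = 0 ∧ b = 0 := by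
  have e0 : (fun t : ℝ => t * a + t ^ 2 * b) =o[𝓝 0] fun t : ℝ => t ^ 1 :=
    h.trans_isLittleO <| by
      simpa using (isLittleO_pow_pow (𝕜 := ℝ) (m := 1) (n := 3) (by norm_num)).norm_left
  have e1 : (fun t : ℝ => t ^ 2 * b) =o[𝓝 0] fun t : ℝ => t ^ 1 :=
    IsBigO.trans_isLittleO (g := fun t : ℝ => t ^ 2)
      (by simpa [mul_comm] using isBigO_const_mul_self b (fun t : ℝ => t ^ 2) (𝓝 0))
      (isLittleO_pow_pow (by norm_num))
  have ha : a = 0 := by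
    have e2 : (fun t : ℝ => t * a) =o[𝓝 0] fun t : ℝ => t ^ 1 := by simpa using e0.sub e1
    by_contra ha
    have e3 : (fun t : ℝ => t) =o[𝓝 0] fun t : ℝ => t := by
      have := (isLittleO_const_mul_left_iff (c := a) (f := fun t : ℝ => t) (g := fun t : ℝ => t)
        (l := 𝓝 0) ha).1 (by simpa [mul_comm] using e2)
      exact this
    -- Little-o of itself is contradictory only where the function is nonzero, hence the punctured
    -- neighbourhood.
    have e4 := e3.mono (nhdsWithin_le_nhds (s := {0}ᶜ))
    exact (isLittleO_irrefl (f'' := fun t : ℝ => t) (l := 𝓝[≠] 0)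
      (Eventually.frequently (by filter_upwards [self_mem_nhdsWithin] with t ht using ht))) e4
  refine ⟨ha, ?_⟩
  by_contra hb
  subst ha
  have e2 : (fun t : ℝ => b * t ^ 2) =o[𝓝 0] fun t : ℝ => t ^ 2 := by
    refine IsBigO.trans_isLittleO (g := fun t : ℝ => ‖t‖ ^ 3) (by simpa [mul_comm] using h) ?_
    simpa using (isLittleO_pow_pow (𝕜 := ℝ) (m := 2) (n := 3) (by norm_num)).norm_left
  have e3 := (isLittleO_const_mul_left_iff hb).1 e2
  have e4 := e3.mono (nhdsWithin_le_nhds (s := {0}ᶜ))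
  exact (isLittleO_irrefl (f'' := fun t : ℝ => t ^ 2) (l := 𝓝[≠] 0)
    (Eventually.frequently (by
      filter_upwards [self_mem_nhdsWithin] with t ht using pow_ne_zero 2 ht))) e4

/-- A smooth function that is `O(|x|³)` has vanishing `2`-jet. -/
lemma fderiv_eq_zero_of_isBigO_cube {f : V → ℝ} (hf : ContDiffAt ℝ ∞ f 0)
    (hO : f =O[𝓝 0] fun x => ‖x‖ ^ 3) :
    f 0 = 0 ∧ fderiv ℝ f 0 = 0 ∧ fderiv ℝ (fderiv ℝ f) 0 = 0 := by
  have h0 : f 0 = 0 := by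
    exact IsBigO.eq_zero_of_norm_pow (x₀ := (0 : V)) (n := 3) (by simpa using hO) (by norm_num)
  set A := fderiv ℝ f 0
  set Q := fderiv ℝ (fderiv ℝ f) 0
  have hQ : ∀ v w, Q v w = Q w v :=
    (hf.of_le one_add_one_le_infty).isSymmSndFDerivAt (by simp [one_add_one_eq_two])
  -- The Taylor polynomial of degree two: `f - q` is cubic by the previous lemma and `f` by
  -- assumption, so `q` is too, and restriction to lines kills its two coefficients.
  let q : V → ℝ := fun x => A x + (1 / 2) * Q x x
  have hq' : ∀ x, HasFDerivAt q (A + Q x) x := by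
    intro x
    have h1 := A.hasFDerivAt (x := x)
    have h2 := (Q.hasFDerivAt (x := x)).clm_apply (hasFDerivAt_id x)
    refine (h1.add (h2.const_mul (1 / 2 : ℝ))).congr_fderiv ?_
    ext v
    simp [hQ v x]; ring
  have hqc : ContDiff ℝ ∞ q := by
    have : ContDiff ℝ ∞ fun x => Q x x := Q.contDiff.clm_apply contDiff_id
    exact A.contDiff.add (contDiff_const.mul this)
  have hq1 : fderiv ℝ q = fun x => A + Q x := funext fun x => (hq' x).fderiv
  have hcube := isBigO_cube_of_fderiv_eq_zero (hf.sub hqc.contDiffAt) (f := f - q)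
    (by rw [fderiv_sub (hf.differentiableAt (by simp)) (hq' 0).differentiableAt, hq1]; simp [A])
    (by
      have e : fderiv ℝ (f - q) =ᶠ[𝓝 0] fun x => fderiv ℝ f x - (A + Q x) := by
        filter_upwards [(hf.of_le one_add_one_le_infty).eventually (by simp [one_add_one_eq_two])]
          with x hx
        rw [fderiv_sub (hx.differentiableAt (by simp)) (hq' x).differentiableAt, hq1]
      rw [e.fderiv_eq]
      have d1 : HasFDerivAt (fderiv ℝ f) Q 0 :=
        ((hf.fderiv_right (m := 1) one_add_one_le_infty).differentiableAt (by simp)).hasFDerivAt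
      have := (d1.sub ((Q.hasFDerivAt (x := 0)).const_add A)).fderiv
      simpa [Pi.sub_def] using this)
  have hqO : q =O[𝓝 0] fun x => ‖x‖ ^ 3 := by
    have := hO.sub hcube
    refine this.congr_left fun x => ?_
    simp [h0, q]
  have hline : ∀ v : V, A v = 0 ∧ (1 / 2) * Q v v = 0 := by
    intro v
    apply eq_zero_of_isBigO_cube
    have ht : Tendsto (fun t : ℝ => t • v) (𝓝 0) (𝓝 0) := by
      have : Continuous fun t : ℝ => t • v := by fun_prop
      simpa using this.tendsto 0
    have h1 := hqO.comp_tendsto ht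
    have h2 : (fun t : ℝ => ‖t • v‖ ^ 3) =O[𝓝 0] fun t => ‖t‖ ^ 3 := by
      refine IsBigO.of_bound (‖v‖ ^ 3) (Eventually.of_forall fun t => ?_)
      simp [norm_smul, mul_pow, mul_comm]
    refine (h1.trans h2).congr_left fun t => ?_
    simp [q]; ring
  refine ⟨h0, ContinuousLinearMap.ext fun v => (hline v).1, ?_⟩
  -- Polarization: a symmetric form that vanishes on the diagonal is zero.
  ext v w
  have h1 := (hline (v + w)).2
  have h2 := (hline v).2
  have h3 := (hline w).2
  simp only [map_add, add_apply] at h1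
  have := hQ v w
  simp only [zero_apply]
  linarith

end Calculus

/-! ### From complex to real differentiability on manifolds. -/

section RestrictScalars

/-- The chart depends only on the partial equivalence underlying the model. Stating this as a
hypothesis, which is `rfl` in each use, covers the product models of total spaces as well. -/
lemma extChartAt_congr_model {E : Type*} [NormedAddCommGroup E] [NormedSpace ℂ E]
    [NormedSpace ℝ E] {H : Type*} [TopologicalSpace H] {I : ModelWithCorners ℂ E H}
    {Ir : ModelWithCorners ℝ E H} {M : Type*} [TopologicalSpace M] [ChartedSpace H M]
    (hI : Ir.toPartialEquiv = I.toPartialEquiv) (x : M) :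
    extChartAt Ir x = extChartAt I x := by
  simp only [extChartAt, OpenPartialHomeomorph.extend, hI]

variable {E : Type*} [NormedAddCommGroup E] [NormedSpace ℂ E] [NormedSpace ℝ E]
  [IsScalarTower ℝ ℂ E] {H : Type*} [TopologicalSpace H]
  {I : ModelWithCorners ℂ E H} {Ir : ModelWithCorners ℝ E H}
  {F : Type*} [NormedAddCommGroup F] [NormedSpace ℂ F] [NormedSpace ℝ F] [IsScalarTower ℝ ℂ F]
  {H' : Type*} [TopologicalSpace H']
  {J : ModelWithCorners ℂ F H'} {Jr : ModelWithCorners ℝ F H'}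
  {M : Type*} [TopologicalSpace M] [ChartedSpace H M]
  {N : Type*} [TopologicalSpace N] [ChartedSpace H' N]

lemma contMDiffAt_restrictScalars (hI : Ir.toPartialEquiv = I.toPartialEquiv)
    (hJ : Jr.toPartialEquiv = J.toPartialEquiv) {n : WithTop ℕ∞} {f : M → N} {x : M}
    (h : ContMDiffAt I J n f x) : ContMDiffAt Ir Jr n f x := by
  rw [contMDiffAt_iff] at h ⊢
  refine ⟨h.1, ?_⟩
  rw [extChartAt_congr_model hI, extChartAt_congr_model hJ]
  have hr : range Ir = range I := by
    rw [← Ir.target_eq, ← I.target_eq, hI]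
  rw [hr]
  exact h.2.restrict_scalars ℝ

lemma hasMFDerivAt_restrictScalars (hI : Ir.toPartialEquiv = I.toPartialEquiv)
    (hJ : Jr.toPartialEquiv = J.toPartialEquiv) {f : M → N} {x : M} {f' : E →L[ℂ] F}
    (h : HasMFDerivAt I J f x f') : HasMFDerivAt Ir Jr f x (f'.restrictScalars ℝ) := by
  refine ⟨h.1, ?_⟩
  have h2 := h.2
  simp only [writtenInExtChartAt] at h2 ⊢
  rw [extChartAt_congr_model hI, extChartAt_congr_model hJ]
  have hr : range Ir = range I := by
    rw [← Ir.target_eq, ← I.target_eq, hI]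
  rw [hr]
  exact HasFDerivWithinAt.restrictScalars ℝ h2

lemma map_smul_I_of_mdifferentiableAt (hI : Ir.toPartialEquiv = I.toPartialEquiv)
    (hJ : Jr.toPartialEquiv = J.toPartialEquiv) {f : M → N} {x : M}
    (h : MDifferentiableAt I J f x) {A : E →L[ℝ] F} (hA : HasMFDerivAt Ir Jr f x A) (v : E) :
    A (Complex.I • v) = Complex.I • A v := by
  let B : E →L[ℂ] F := mfderiv I J f x
  have hB : HasMFDerivAt Ir Jr f x (B.restrictScalars ℝ) :=
    hasMFDerivAt_restrictScalars hI hJ h.hasMFDerivAt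
  have : A = B.restrictScalars ℝ := hasMFDerivAt_unique hA hB
  rw [this]
  exact B.map_smul Complex.I v

end RestrictScalars

lemma isManifold_real {E : Type*} [NormedAddCommGroup E] [NormedSpace ℂ E] [NormedSpace ℝ E]
    [IsScalarTower ℝ ℂ E] (M : Type*) [TopologicalSpace M] [ChartedSpace E M]
    [IsManifold 𝓘(ℂ, E) ω M] : IsManifold 𝓘(ℝ, E) ∞ M := by
  refine isManifold_of_contDiffOn _ _ _ fun e e' he he' => ?_
  have h := (contDiffGroupoid ω 𝓘(ℂ, E)).compatible he he'
  have h1 := (contDiffGroupoid_le (I := 𝓘(ℂ, E)) (m := ∞) le_top) h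
  have h2 : e.symm ≫ₕ e' ∈ (contDiffPregroupoid ∞ 𝓘(ℂ, E)).groupoid := h1
  rw [mem_groupoid_of_pregroupoid] at h2
  exact ContDiffOn.restrict_scalars ℝ h2.1

/-! ### The form `∂φ` in holomorphic charts. -/

section Coordinates

variable {m : ℕ} {M : Type*} [TopologicalSpace M] [ChartedSpace (Cm m) M]

lemma contMDiffAt_real_of_mem_maximalAtlas {χ : OpenPartialHomeomorph M (Cm m)}
    (hχ : χ ∈ IsManifold.maximalAtlas 𝓘(ℂ, Cm m) ω M) {x : M} (hx : x ∈ χ.source) :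
    ContMDiffAt 𝓘(ℝ, Cm m) 𝓘(ℝ, Cm m) ∞ χ x :=
  (contMDiffAt_restrictScalars (I := 𝓘(ℂ, Cm m)) (J := 𝓘(ℂ, Cm m)) rfl rfl
    (contMDiffAt_of_mem_maximalAtlas hχ hx)).of_le le_top

lemma contMDiffAt_real_symm_of_mem_maximalAtlas {χ : OpenPartialHomeomorph M (Cm m)}
    (hχ : χ ∈ IsManifold.maximalAtlas 𝓘(ℂ, Cm m) ω M) {w : Cm m} (hw : w ∈ χ.target) :
    ContMDiffAt 𝓘(ℝ, Cm m) 𝓘(ℝ, Cm m) ∞ χ.symm w :=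
  (contMDiffAt_restrictScalars (I := 𝓘(ℂ, Cm m)) (J := 𝓘(ℂ, Cm m)) rfl rfl
    (contMDiffAt_symm_of_mem_maximalAtlas hχ hw)).of_le le_top

/-- The form `∂φ`, pulled back by a map, can be computed in any holomorphic chart. -/
lemma delPart_comp_eq_of_mem_maximalAtlas {χ : OpenPartialHomeomorph M (Cm m)}
    (hχ : χ ∈ IsManifold.maximalAtlas 𝓘(ℂ, Cm m) ω M)
    {V : Type*} [NormedAddCommGroup V] [NormedSpace ℝ V] {y : V → M} {w : V}
    (hy : y w ∈ χ.source) {φ : M → ℝ} {A : Cm m →L[ℝ] ℝ} {Y : V →L[ℝ] Cm m}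
    (hA : HasMFDerivAt 𝓘(ℝ, Cm m) 𝓘(ℝ, ℝ) φ (y w) A)
    (hY : HasMFDerivAt 𝓘(ℝ, V) 𝓘(ℝ, Cm m) y w Y) :
    (delPart (Cm m) A).comp Y =
      (delPart (Cm m) (fderiv ℝ (φ ∘ χ.symm) (χ (y w)))).comp (fderiv ℝ (χ ∘ y) w) := by
  have hc := contMDiffAt_real_of_mem_maximalAtlas hχ hy
  have hs := contMDiffAt_real_symm_of_mem_maximalAtlas hχ (χ.map_source hy)
  let C : Cm m →L[ℝ] Cm m := mfderiv 𝓘(ℝ, Cm m) 𝓘(ℝ, Cm m) χ (y w)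
  let S : Cm m →L[ℝ] Cm m := mfderiv 𝓘(ℝ, Cm m) 𝓘(ℝ, Cm m) χ.symm (χ (y w))
  have hC : HasMFDerivAt 𝓘(ℝ, Cm m) 𝓘(ℝ, Cm m) χ (y w) C :=
    (hc.mdifferentiableAt (by simp)).hasMFDerivAt
  have hS : HasMFDerivAt 𝓘(ℝ, Cm m) 𝓘(ℝ, Cm m) χ.symm (χ (y w)) S :=
    (hs.mdifferentiableAt (by simp)).hasMFDerivAt
  have hSC : S.comp C = ContinuousLinearMap.id ℝ (Cm m) := by
    have h1 : HasMFDerivAt 𝓘(ℝ, Cm m) 𝓘(ℝ, Cm m) (χ.symm ∘ χ) (y w) (S.comp C) := hS.comp _ hC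
    have h2 : HasMFDerivAt 𝓘(ℝ, Cm m) 𝓘(ℝ, Cm m) (χ.symm ∘ χ) (y w)
        (ContinuousLinearMap.id ℝ (Cm m)) := by
      refine (hasMFDerivAt_id (y w)).congr_of_eventuallyEq ?_
      filter_upwards [χ.open_source.mem_nhds hy] with x hx using χ.left_inv hx
    exact hasMFDerivAt_unique h1 h2
  have hφ : fderiv ℝ (φ ∘ χ.symm) (χ (y w)) = A.comp S := by
    have hA' : HasMFDerivAt 𝓘(ℝ, Cm m) 𝓘(ℝ, ℝ) φ (χ.symm (χ (y w))) A := by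
      rwa [χ.left_inv hy]
    have h1 : HasMFDerivAt 𝓘(ℝ, Cm m) 𝓘(ℝ, ℝ) (φ ∘ χ.symm) (χ (y w)) (A.comp S) :=
      hA'.comp _ hS
    have h2 : HasFDerivAt (φ ∘ χ.symm) (A.comp S) (χ (y w)) := hasMFDerivAt_iff_hasFDerivAt.1 h1
    exact h2.fderiv
  have hγ : fderiv ℝ (χ ∘ y) w = C.comp Y := by
    have h1 : HasMFDerivAt 𝓘(ℝ, V) 𝓘(ℝ, Cm m) (χ ∘ y) w (C.comp Y) := hC.comp _ hY
    have h2 : HasFDerivAt (χ ∘ y) (C.comp Y) w := hasMFDerivAt_iff_hasFDerivAt.1 h1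
    exact h2.fderiv
  have hSI : ∀ v, S (Complex.I • v) = Complex.I • S v :=
    map_smul_I_of_mdifferentiableAt (I := 𝓘(ℂ, Cm m)) (J := 𝓘(ℂ, Cm m)) rfl rfl
      ((contMDiffAt_symm_of_mem_maximalAtlas hχ (χ.map_source hy)).mdifferentiableAt (by simp)) hS
  rw [hφ, hγ, delPart_comp _ _ hSI]
  ext v
  have : S (C (Y v)) = Y v := congrArg (fun B : Cm m →L[ℝ] Cm m => B (Y v)) hSC
  simp [this]

end Coordinates

/-! ### Holomorphic frames, their potentials, and the curvature form. -/

section Frames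

set_option linter.unusedSectionVars false

variable {m : ℕ} {M : Type*} [TopologicalSpace M] [ChartedSpace (Cm m) M]
  {L : M → Type*} [TopologicalSpace (Bundle.TotalSpace ℂ L)]
  [∀ x, NormedAddCommGroup (L x)] [∀ x, InnerProductSpace ℂ (L x)]
  [FiberBundle ℂ L] [VectorBundle ℂ ℂ L]

variable (m) in
/-- `s` is a nowhere vanishing holomorphic section near `x₀`. -/
def IsHolomorphicFrameAt (s : ∀ x, L x) (x₀ : M) : Prop :=
  ∀ᶠ x in 𝓝 x₀, ContMDiffAt 𝓘(ℂ, Cm m) (𝓘(ℂ, Cm m).prod 𝓘(ℂ, ℂ)) ω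
    (fun y => Bundle.TotalSpace.mk' ℂ y (s y)) x ∧ s x ≠ 0

lemma IsHolomorphicFrameAt.eventually {s : ∀ x, L x} {x₀ : M}
    (h : IsHolomorphicFrameAt m s x₀) : ∀ᶠ x in 𝓝 x₀, IsHolomorphicFrameAt m s x :=
  eventually_eventually_nhds.2 h

lemma IsHolomorphicFrameAt.ne_zero {s : ∀ x, L x} {x₀ : M}
    (h : IsHolomorphicFrameAt m s x₀) : s x₀ ≠ 0 := h.self_of_nhds.2

lemma isHolomorphicFrameAt_trivializationAt [IsManifold 𝓘(ℂ, Cm m) ω M]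
    [ContMDiffVectorBundle ω ℂ L 𝓘(ℂ, Cm m)] (x₀ : M) {x : M}
    (hx : x ∈ (trivializationAt ℂ L x₀).baseSet) :
    IsHolomorphicFrameAt m (fun y => (trivializationAt ℂ L x₀).symm y 1) x := by
  set e := trivializationAt ℂ L x₀
  have hval : ∀ y ∈ e.baseSet, e ⟨y, e.symm y 1⟩ = (y, 1) := fun y hy => e.apply_mk_symm hy 1
  filter_upwards [e.open_baseSet.mem_nhds hx] with y hy
  constructor
  · rw [e.contMDiffAt_section_iff hy]
    refine (contMDiffAt_const (c := (1 : ℂ))).congr_of_eventuallyEq ?_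
    filter_upwards [e.open_baseSet.mem_nhds hy] with y' hy'
    rw [hval y' hy']
  · intro h0
    have h1 := hval y hy
    have h2 := e.zeroSection ℂ hy
    change e ⟨y, 0⟩ = (y, 0) at h2
    rw [show e.symm y 1 = 0 from h0, h2] at h1
    simpa using congrArg Prod.snd h1

/-- Two holomorphic frames differ by a nowhere vanishing holomorphic function. -/
lemma IsHolomorphicFrameAt.exists_ratio [ContMDiffVectorBundle ω ℂ L 𝓘(ℂ, Cm m)]
    {s s' : ∀ x, L x} {x₀ : M} (h : IsHolomorphicFrameAt m s x₀)
    (h' : IsHolomorphicFrameAt m s' x₀) :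
    ∃ f : M → ℂ, ∀ᶠ x in 𝓝 x₀, ContMDiffAt 𝓘(ℂ, Cm m) 𝓘(ℂ, ℂ) ω f x ∧ f x ≠ 0 ∧
      s' x = f x • s x := by
  set e := trivializationAt ℂ L x₀
  have hcoord : ∀ (t : ∀ x, L x) (x : M), x ∈ e.baseSet → e.symm x (e ⟨x, t x⟩).2 = t x :=
    fun t x hx => e.symm_apply_apply_mk hx (t x)
  have hne : ∀ (t : ∀ x, L x) (x : M), x ∈ e.baseSet → t x ≠ 0 → (e ⟨x, t x⟩).2 ≠ 0 := by
    intro t x hx ht h0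
    apply ht
    rw [← hcoord t x hx, h0]
    have := (e.symmₗ ℂ x).map_zero
    rwa [e.coe_symmₗ] at this
    exact hx
  refine ⟨fun x => (e ⟨x, s' x⟩).2 / (e ⟨x, s x⟩).2, ?_⟩
  filter_upwards [h, h', e.open_baseSet.mem_nhds (FiberBundle.mem_baseSet_trivializationAt' x₀)]
    with x hx hx' hxe
  have n1 := hne s x hxe hx.2
  have n2 := hne s' x hxe hx'.2
  refine ⟨?_, div_ne_zero n2 n1, ?_⟩
  · have c1 := (e.contMDiffAt_section_iff hxe).1 hx.1
    have c2 := (e.contMDiffAt_section_iff hxe).1 hx'.1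
    exact c2.div₀ c1 n1
  · have := (e.symmₗ ℂ x).map_smul ((e ⟨x, s' x⟩).2 / (e ⟨x, s x⟩).2) (e ⟨x, s x⟩).2
    rw [e.coe_symmₗ, hcoord s x hxe, smul_eq_mul, div_mul_cancel₀ _ n1, hcoord s' x hxe] at this
    · exact this
    · exact hxe

lemma IsHolomorphicFrameAt.contMDiffAt_potential {s : ∀ x, L x} {x : M}
    (h : IsHolomorphicFrameAt m s x) (hh : IsSmoothHermitianMetric (m := m) L) :
    ContMDiffAt 𝓘(ℝ, Cm m) 𝓘(ℝ, ℝ) ∞ (potential s) x := by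
  have h1 : ContMDiffAt 𝓘(ℝ, Cm m) (𝓘(ℝ, Cm m).prod 𝓘(ℝ, ℂ)) ∞
      (fun y => Bundle.TotalSpace.mk' ℂ y (s y)) x :=
    (contMDiffAt_restrictScalars (I := 𝓘(ℂ, Cm m)) (J := 𝓘(ℂ, Cm m).prod 𝓘(ℂ, ℂ)) rfl rfl
      h.self_of_nhds.1).of_le le_top
  have h2 : ContMDiffAt 𝓘(ℝ, Cm m) 𝓘(ℝ, ℝ) ∞ (fun y => ‖s y‖ ^ 2) x :=
    ContMDiffAt.comp x (hh.contMDiffAt (x := Bundle.TotalSpace.mk' ℂ x (s x))) h1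
  have h3 : ContDiffAt ℝ ∞ (fun r : ℝ => -Real.log r) (‖s x‖ ^ 2) :=
    (Real.contDiffAt_log.2 (by simpa using h.ne_zero)).neg
  exact ContMDiffAt.comp (f := fun y => ‖s y‖ ^ 2) (g := fun r : ℝ => -Real.log r) x
    h3.contMDiffAt h2

lemma potential_smul {s s' : ∀ x, L x} {x : M} {c : ℂ} (hs : s x ≠ 0) (hc : c ≠ 0)
    (h : s' x = c • s x) : potential s' x = potential s x - Real.log (‖c‖ ^ 2) := by
  have h1 : ‖s x‖ ^ 2 ≠ 0 := by simpa using hs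
  have h2 : ‖c‖ ^ 2 ≠ 0 := by simpa using hc
  rw [potential, potential, h, norm_smul, mul_pow, Real.log_mul h2 h1]
  ring

lemma hasMFDerivAt_log_norm_sq {E : Type*} [NormedAddCommGroup E] [NormedSpace ℝ E]
    {H : Type*} [TopologicalSpace H] {I : ModelWithCorners ℝ E H}
    {N : Type*} [TopologicalSpace N] [ChartedSpace H N] {f : N → ℂ} {x : N} {f' : E →L[ℝ] ℂ}
    (hf : HasMFDerivAt I 𝓘(ℝ, ℂ) f x f') (h0 : f x ≠ 0) :
    HasMFDerivAt I 𝓘(ℝ, ℝ) (fun y => Real.log (‖f y‖ ^ 2)) x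
      ((2 : ℝ) • Complex.reCLM.comp ((f x)⁻¹ • f')) := by
  have h1 : HasFDerivAt (fun z : ℂ => Real.log (‖z‖ ^ 2))
      ((2 : ℝ) • Complex.reCLM.comp ((f x)⁻¹ • ContinuousLinearMap.id ℝ ℂ)) (f x) :=
    hasFDerivAt_log_norm_sq (f := fun z : ℂ => z) (hasFDerivAt_id (f x)) h0
  exact (h1.hasMFDerivAt.comp x hf).congr_mfderiv (by ext v; rfl)

/-- From `φ' = φ - log |f|²` and `∂ log |f|² = df / f`. The correction is the logarithmic derivative
that the multiplier acquires under a change of frame. -/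
lemma delPart_potential_smul {s s' : ∀ x, L x} {f : M → ℂ} {x : M}
    (h : ∀ᶠ y in 𝓝 x, s y ≠ 0 ∧ f y ≠ 0 ∧ s' y = f y • s y)
    (hf : MDifferentiableAt 𝓘(ℂ, Cm m) 𝓘(ℂ, ℂ) f x)
    {A A' : Cm m →L[ℝ] ℝ} {f' : Cm m →L[ℝ] ℂ}
    (hA : HasMFDerivAt 𝓘(ℝ, Cm m) 𝓘(ℝ, ℝ) (potential s) x A)
    (hA' : HasMFDerivAt 𝓘(ℝ, Cm m) 𝓘(ℝ, ℝ) (potential s') x A')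
    (hf' : HasMFDerivAt 𝓘(ℝ, Cm m) 𝓘(ℝ, ℂ) f x f') :
    delPart (Cm m) A' = delPart (Cm m) A - (f x)⁻¹ • f' := by
  have h0 := h.self_of_nhds.2.1
  have e : potential s' =ᶠ[𝓝 x] fun y => potential s y - Real.log (‖f y‖ ^ 2) :=
    h.mono fun y hy => potential_smul hy.1 hy.2.1 hy.2.2
  have h1 : HasMFDerivAt 𝓘(ℝ, Cm m) 𝓘(ℝ, ℝ) (fun y => potential s y - Real.log (‖f y‖ ^ 2)) x
      (A - (2 : ℝ) • Complex.reCLM.comp ((f x)⁻¹ • f')) :=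
    hA.sub (hasMFDerivAt_log_norm_sq hf' h0)
  have h2 : A' = A - (2 : ℝ) • Complex.reCLM.comp ((f x)⁻¹ • f') :=
    hasMFDerivAt_unique (hA'.congr_of_eventuallyEq e.symm) h1
  have hI : ∀ v, f' (Complex.I • v) = Complex.I • f' v :=
    map_smul_I_of_mdifferentiableAt (I := 𝓘(ℂ, Cm m)) (J := 𝓘(ℂ, ℂ)) rfl rfl hf hf'
  rw [h2, map_sub, delPart_two_re]
  intro v
  simp [hI]; ring

/-- The curvature form can be computed in any holomorphic chart and frame. -/
lemma curvatureForm_eq_iddbar [IsManifold 𝓘(ℂ, Cm m) ω M]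
    [ContMDiffVectorBundle ω ℂ L 𝓘(ℂ, Cm m)] (hh : IsSmoothHermitianMetric (m := m) L)
    {χ : OpenPartialHomeomorph M (Cm m)} (hχ : χ ∈ IsManifold.maximalAtlas 𝓘(ℂ, Cm m) ω M)
    {x : M} (hx : x ∈ χ.source) {s : ∀ x, L x} (hs : IsHolomorphicFrameAt m s x)
    {C : Cm m →L[ℝ] Cm m} (hC : HasMFDerivAt 𝓘(ℝ, Cm m) 𝓘(ℝ, Cm m) χ x C) (u v : Cm m) :
    curvatureForm (m := m) L x u v = iddbar (potential s ∘ χ.symm) (χ x) (C u) (C v) := by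
  set κ := chartAt (Cm m) x
  have hxκ : x ∈ κ.source := mem_chart_source _ x
  have hκ : κ ∈ IsManifold.maximalAtlas 𝓘(ℂ, Cm m) ω M := IsManifold.chart_mem_maximalAtlas x
  set s₀ : ∀ y, L y := fun y => (trivializationAt ℂ L x).symm y 1
  have hs₀ : IsHolomorphicFrameAt m s₀ x :=
    isHolomorphicFrameAt_trivializationAt x (FiberBundle.mem_baseSet_trivializationAt' x)
  obtain ⟨f, hf⟩ := hs₀.exists_ratio hs
  set c := κ x
  have hcκ : c ∈ κ.target := κ.map_source hxκ
  have hκc : κ.symm c = x := κ.left_inv hxκ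
  have hsymm : Tendsto κ.symm (𝓝 c) (𝓝 x) := by
    have := (κ.continuousAt_symm hcκ).tendsto
    rwa [hκc] at this
  set τ : Cm m → Cm m := χ ∘ κ.symm
  have hκsm : ContMDiffAt 𝓘(ℂ, Cm m) 𝓘(ℂ, Cm m) ω κ.symm c :=
    contMDiffAt_symm_of_mem_maximalAtlas hκ hcκ
  have hτ : ContDiffAt ℂ 2 τ c := by
    have h1 : ContMDiffAt 𝓘(ℂ, Cm m) 𝓘(ℂ, Cm m) ω χ (κ.symm c) := by
      rw [hκc]; exact contMDiffAt_of_mem_maximalAtlas hχ hx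
    exact ((h1.comp c hκsm).contDiffAt).of_le le_top
  have hg : ContDiffAt ℂ 2 (f ∘ κ.symm) c := by
    have h1 : ContMDiffAt 𝓘(ℂ, Cm m) 𝓘(ℂ, ℂ) ω f (κ.symm c) := by
      rw [hκc]; exact hf.self_of_nhds.1
    exact ((h1.comp c hκsm).contDiffAt).of_le le_top
  have hg0 : (f ∘ κ.symm) c ≠ 0 := by
    simp only [Function.comp_apply, hκc]; exact hf.self_of_nhds.2.1
  set φ := potential s ∘ χ.symm
  have hτc : τ c = χ x := by simp [τ, hκc]
  have hφ : ContDiffAt ℝ ∞ φ (χ x) := by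
    have h1 : ContMDiffAt 𝓘(ℝ, Cm m) 𝓘(ℝ, ℝ) ∞ (potential s) (χ.symm (χ x)) := by
      rw [χ.left_inv hx]; exact hs.contMDiffAt_potential hh
    exact (h1.comp _ (contMDiffAt_real_symm_of_mem_maximalAtlas hχ (χ.map_source hx))).contDiffAt
  have hφ2 : ContDiffAt ℝ 2 φ (τ c) := by
    rw [hτc]; exact hφ.of_le (by simpa [one_add_one_eq_two] using one_add_one_le_infty)
  -- The potentials in the two frames differ by the pluriharmonic term `log |f|²`, which the Levi
  -- form does not see.
  have e : (fun w => potential s₀ (κ.symm w)) =ᶠ[𝓝 c]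
      fun w => (φ ∘ τ) w + Real.log (‖(f ∘ κ.symm) w‖ ^ 2) := by
    filter_upwards [hsymm.eventually hf, hsymm.eventually hs₀,
      hsymm.eventually (χ.open_source.mem_nhds hx)] with w h1 h2 h3
    have := potential_smul h2.2 h1.2.1 h1.2.2
    simp only [φ, τ, Function.comp_apply, χ.left_inv h3, this]
    ring
  have hτR : ContDiffAt ℝ 2 τ c := hτ.restrict_scalars ℝ
  have hgR : ContDiffAt ℝ 2 (f ∘ κ.symm) c := hg.restrict_scalars ℝ
  have d1 : ContDiffAt ℝ 2 (φ ∘ τ) c := hφ2.comp c hτR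
  have d2 : ContDiffAt ℝ 2 (fun w => Real.log (‖(f ∘ κ.symm) w‖ ^ 2)) c :=
    (hgR.norm_sq ℝ).log (by simpa using hg0)
  have hD : fderiv ℝ (fderiv ℝ fun w => potential s₀ (κ.symm w)) c =
      fderiv ℝ (fderiv ℝ (φ ∘ τ)) c
        + fderiv ℝ (fderiv ℝ (fun w => Real.log (‖(f ∘ κ.symm) w‖ ^ 2))) c := by
    rw [(e.fderiv (𝕜 := ℝ)).fderiv_eq]
    have e2 : fderiv ℝ (fun w => (φ ∘ τ) w + Real.log (‖(f ∘ κ.symm) w‖ ^ 2)) =ᶠ[𝓝 c]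
        fun w => fderiv ℝ (φ ∘ τ) w
          + fderiv ℝ (fun w => Real.log (‖(f ∘ κ.symm) w‖ ^ 2)) w := by
      filter_upwards [d1.eventually (by simp), d2.eventually (by simp)] with w h1 h2
      exact fderiv_add (h1.differentiableAt (by simp)) (h2.differentiableAt (by simp))
    rw [e2.fderiv_eq]
    exact fderiv_add
      ((d1.fderiv_right (m := 1) (by norm_num)).differentiableAt (by simp))
      ((d2.fderiv_right (m := 1) (by norm_num)).differentiableAt (by simp))
  -- Tangent vectors at `x` are read in the preferred chart `κ`, so the manifold derivative of `χ`
  -- at `x` is by definition the derivative of `χ ∘ κ.symm`.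
  have hDτ : fderiv ℝ τ c = C := by
    have h1 : HasFDerivWithinAt τ C (range 𝓘(ℝ, Cm m)) c := hC.2
    rw [show range 𝓘(ℝ, Cm m) = univ from range_id, hasFDerivWithinAt_univ] at h1
    exact h1.fderiv
  have k1 := levi_comp hφ2 hτ u v
  have k2 := levi_log_norm_sq hg hg0 u v
  rw [hDτ, hτc] at k1
  change iddbar (fun w => potential s₀ (κ.symm w)) c u v = _
  rw [iddbar, iddbar, hD]
  simp only [add_apply]
  linear_combination (1 / 2) * k1 + (1 / 2) * k2

end Frames

/-! ### The fibre coordinate on `L*` and its differential equation along the contact flow. -/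

section Evaluation

set_option linter.unusedSectionVars false

variable {m : ℕ} {M : Type*} [TopologicalSpace M] [ChartedSpace (Cm m) M]
  {L : M → Type*} [TopologicalSpace (Bundle.TotalSpace ℂ L)]
  [∀ x, NormedAddCommGroup (L x)] [∀ x, InnerProductSpace ℂ (L x)]
  [FiberBundle ℂ L] [VectorBundle ℂ ℂ L]

/-- The holomorphic fibre coordinate of `L*` defined by a section `s` of `L`. -/
def fibreCoord (s : ∀ x, L x) (q : DualTotal L) : ℂ := q.2 (s q.1)

lemma finrank_fibre (x : M) : Module.finrank ℂ (L x) = 1 := by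
  have e := (trivializationAt ℂ L x).continuousLinearEquivAt ℂ x
    (FiberBundle.mem_baseSet_trivializationAt' x)
  rw [e.toLinearEquiv.finrank_eq, Module.finrank_self]

/-- The fibre is a line spanned by `s`, so the operator norm of a functional is attained at `s`. -/
lemma norm_fibreCoord (s : ∀ x, L x) (q : DualTotal L) (hs : s q.1 ≠ 0) :
    ‖fibreCoord s q‖ = ‖q.2‖ * ‖s q.1‖ := by
  refine le_antisymm (q.2.le_opNorm _) ?_
  have hpos : 0 < ‖s q.1‖ := norm_pos_iff.2 hs
  rw [← le_div_iff₀ hpos]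
  refine ContinuousLinearMap.opNorm_le_bound _ (by positivity) fun v => ?_
  obtain ⟨c, rfl⟩ := exists_smul_eq_of_finrank_eq_one (finrank_fibre q.1) hs v
  rw [map_smul, norm_smul, norm_smul]
  have : ‖fibreCoord s q‖ / ‖s q.1‖ * (‖c‖ * ‖s q.1‖) = ‖c‖ * ‖fibreCoord s q‖ := by
    field_simp
  rw [this]
  exact le_rfl

lemma rho_eq (s : ∀ x, L x) (q : DualTotal L) (h : fibreCoord s q ≠ 0) :
    rho L q = -Real.log (‖fibreCoord s q‖ ^ 2) - potential s q.1 := by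
  have hs : s q.1 ≠ 0 := by
    intro h0; apply h; simp [fibreCoord, h0]
  have hq : ‖q.2‖ ≠ 0 := by
    intro h0; apply h
    have := norm_fibreCoord s q hs
    rw [h0, zero_mul] at this
    simpa using this
  rw [norm_fibreCoord s q hs, rho, potential, mul_pow,
    Real.log_mul (pow_ne_zero 2 hq) (pow_ne_zero 2 (norm_ne_zero_iff.2 hs))]
  ring

variable [ContMDiffVectorBundle ω ℂ L 𝓘(ℂ, Cm m)]

lemma contMDiffAt_fibreCoord {s : ∀ x, L x} {q : DualTotal L}
    (hs : IsHolomorphicFrameAt m s q.1) :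
    ContMDiffAt (𝓘(ℂ, Cm m).prod 𝓘(ℂ, ℂ →L[ℂ] ℂ)) 𝓘(ℂ, ℂ) ω (fibreCoord s) q := by
  have h1 : ContMDiffAt (𝓘(ℂ, Cm m).prod 𝓘(ℂ, ℂ →L[ℂ] ℂ)) (𝓘(ℂ, Cm m).prod 𝓘(ℂ, ℂ →L[ℂ] ℂ)) ω
      (fun q : DualTotal L => Bundle.TotalSpace.mk' (ℂ →L[ℂ] ℂ) (E := fun x : M =>
        L x →L[ℂ] Bundle.Trivial M ℂ x) q.1 q.2) q := contMDiffAt_id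
  have h2 : ContMDiffAt (𝓘(ℂ, Cm m).prod 𝓘(ℂ, ℂ →L[ℂ] ℂ)) (𝓘(ℂ, Cm m).prod 𝓘(ℂ, ℂ)) ω
      (fun q : DualTotal L => Bundle.TotalSpace.mk' ℂ q.1 (s q.1)) q :=
    ContMDiffAt.comp (f := fun q : DualTotal L => q.1)
      (g := fun y => Bundle.TotalSpace.mk' ℂ y (s y)) q hs.self_of_nhds.1
      (Bundle.contMDiffAt_proj (Dual L))
  have h3 := ContMDiffAt.clm_bundle_apply (F₁ := ℂ) (F₂ := ℂ) h1 h2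
  rw [Bundle.contMDiffAt_totalSpace] at h3
  exact h3.2

/-- The derivative of the fibre coordinate `p ↦ p(s)` along the contact lift of `ξ_H`. -/
lemma IsContactLift.fibreCoord_deriv
    {H : M → ℝ} {ξ : ∀ x : M, TangentSpace 𝓘(ℝ, Cm m) x} {p : CircleBundle L}
    {v : TangentSpace (dualModel m) p.1} (hv : IsContactLift L H ξ p v)
    {s : ∀ x, L x} (hs : IsHolomorphicFrameAt m s p.base)
    {A : Cm m →L[ℝ] ℝ} (hA : HasMFDerivAt 𝓘(ℝ, Cm m) 𝓘(ℝ, ℝ) (potential s) p.base A)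
    {Z : Cm m × (ℂ →L[ℂ] ℂ) →L[ℝ] ℂ}
    (hZ : HasMFDerivAt (dualModel m) 𝓘(ℝ, ℂ) (fibreCoord s) p.1 Z) :
    Z v = -(Complex.I * (H p.base : ℂ) + delPart (Cm m) A (ξ p.base)) * fibreCoord s p.1 := by
  have hs' : IsHolomorphicFrameAt m s p.1.1 := hs
  have hne : fibreCoord s p.1 ≠ 0 := by
    rw [← norm_ne_zero_iff, norm_fibreCoord s p.1 hs.ne_zero, p.2, one_mul]
    exact norm_ne_zero_iff.2 hs.ne_zero
  have hZI : ∀ v, Z (Complex.I • v) = Complex.I • Z v :=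
    map_smul_I_of_mdifferentiableAt (I := 𝓘(ℂ, Cm m).prod 𝓘(ℂ, ℂ →L[ℂ] ℂ)) (J := 𝓘(ℂ, ℂ))
      rfl rfl ((contMDiffAt_fibreCoord hs').mdifferentiableAt (by simp)) hZ
  have hprojC : MDifferentiableAt (𝓘(ℂ, Cm m).prod 𝓘(ℂ, ℂ →L[ℂ] ℂ)) 𝓘(ℂ, Cm m)
      (Bundle.TotalSpace.proj : DualTotal L → M) p.1 :=
    (Bundle.contMDiffAt_proj (n := ω) (Dual L)).mdifferentiableAt (by simp)
  let P : Cm m × (ℂ →L[ℂ] ℂ) →L[ℝ] Cm m :=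
    mfderiv (dualModel m) 𝓘(ℝ, Cm m) (Bundle.TotalSpace.proj : DualTotal L → M) p.1
  have hP : HasMFDerivAt (dualModel m) 𝓘(ℝ, Cm m)
      (Bundle.TotalSpace.proj : DualTotal L → M) p.1 P :=
    (hasMFDerivAt_restrictScalars (I := 𝓘(ℂ, Cm m).prod 𝓘(ℂ, ℂ →L[ℂ] ℂ)) (J := 𝓘(ℂ, Cm m))
      rfl rfl hprojC.hasMFDerivAt).mdifferentiableAt.hasMFDerivAt
  have hPI : ∀ v, P (Complex.I • v) = Complex.I • P v :=
    map_smul_I_of_mdifferentiableAt (I := 𝓘(ℂ, Cm m).prod 𝓘(ℂ, ℂ →L[ℂ] ℂ)) (J := 𝓘(ℂ, Cm m))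
      rfl rfl hprojC hP
  have hrho : HasMFDerivAt (dualModel m) 𝓘(ℝ, ℝ) (rho L) p.1
      (-((2 : ℝ) • Complex.reCLM.comp ((fibreCoord s p.1)⁻¹ • Z)) - A.comp P) := by
    have h1 := (hasMFDerivAt_log_norm_sq hZ hne).neg
    have h2 : HasMFDerivAt (dualModel m) 𝓘(ℝ, ℝ) (fun q : DualTotal L => potential s q.1) p.1
      (A.comp P) := HasMFDerivAt.comp (g := potential s)
        (f := (Bundle.TotalSpace.proj : DualTotal L → M)) p.1 hA hP
    refine (h1.sub h2).congr_of_eventuallyEq ?_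
    filter_upwards [(contMDiffAt_fibreCoord hs').continuousAt.eventually_ne hne] with q hq
    exact rho_eq s q hq
  let w : Cm m × (ℂ →L[ℂ] ℂ) := v
  obtain ⟨h1, h2, h3⟩ := hv
  have h1' : P w = ξ p.base := h1
  rw [hrho.mfderiv] at h2
  simp only [contactForm, dbarRho, hrho.mfderiv] at h3
  change -(2 * ((fibreCoord s p.1)⁻¹ * Z w).re) - A (P w) = 0 at h2
  change -(Complex.I * ((1 / 2) * (((-(2 * ((fibreCoord s p.1)⁻¹ * Z w).re) - A (P w) : ℝ) : ℂ)
    + Complex.I * ((-(2 * ((fibreCoord s p.1)⁻¹ * Z (Complex.I • w)).re)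
      - A (P (Complex.I • w)) : ℝ) : ℂ)))).re = - H p.base at h3
  rw [hZI, hPI, h1'] at h3
  rw [h1'] at h2
  change Z w = _
  set ζ := (fibreCoord s p.1)⁻¹ * Z w with hζ
  have hZζ : Z w = ζ * fibreCoord s p.1 := by
    rw [hζ]; field_simp
  rw [hZζ]
  congr 1
  have hIζ : (fibreCoord s p.1)⁻¹ * (Complex.I • Z w) = Complex.I * ζ := by
    rw [hζ, smul_eq_mul]; ring
  rw [hIζ] at h3
  rw [show delPart (Cm m) A (ξ p.base) = _ from delPart_apply A _]
  -- The real part is tangency to `X`, `dρ(v) = 0`; the imaginary part is `α(v) = -H`, where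
  -- `dρ(Jv)` enters through the complex linearity of `Z` and `P`.
  apply Complex.ext
  · simp
    linarith
  · simp at h3 ⊢
    linarith

/-- Along the contact flow the fibre coordinate satisfies a linear differential equation. -/
lemma IsContactFlow.hasDerivAt_fibreCoord
    {H : M → ℝ} {ξ : ∀ x : M, TangentSpace 𝓘(ℝ, Cm m) x} {G : Flow ℝ (CircleBundle L)}
    (hG : IsContactFlow L H ξ G) (p : CircleBundle L) (t : ℝ)
    {s : ∀ x, L x} (hs : IsHolomorphicFrameAt m s (G t p).base)
    {A : Cm m →L[ℝ] ℝ} (hA : HasMFDerivAt 𝓘(ℝ, Cm m) 𝓘(ℝ, ℝ) (potential s) (G t p).base A) :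
    HasDerivAt (fun r => fibreCoord s (G r p).1)
      (-(Complex.I * (H (G t p).base : ℂ) + delPart (Cm m) A (ξ (G t p).base))
        * fibreCoord s (G t p).1) t := by
  obtain ⟨v, hv, hder⟩ := hG p t
  have hs' : IsHolomorphicFrameAt m s (G t p).1.1 := hs
  let Z : Cm m × (ℂ →L[ℂ] ℂ) →L[ℝ] ℂ :=
    mfderiv (dualModel m) 𝓘(ℝ, ℂ) (fibreCoord s) (G t p).1
  have hZ : HasMFDerivAt (dualModel m) 𝓘(ℝ, ℂ) (fibreCoord s) (G t p).1 Z :=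
    ((contMDiffAt_restrictScalars (I := 𝓘(ℂ, Cm m).prod 𝓘(ℂ, ℂ →L[ℂ] ℂ)) (J := 𝓘(ℂ, ℂ)) rfl rfl
      (contMDiffAt_fibreCoord hs')).mdifferentiableAt (by simp)).hasMFDerivAt
  have h1 : HasMFDerivAt 𝓘(ℝ, ℝ) 𝓘(ℝ, ℂ) (fibreCoord s ∘ fun r => (G r p).1) t
      (Z.comp ((1 : ℝ →L[ℝ] ℝ).smulRight (v : Cm m × (ℂ →L[ℂ] ℂ)))) := hZ.comp t hder
  have h2 : HasFDerivAt (fibreCoord s ∘ fun r => (G r p).1)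
      (Z.comp ((1 : ℝ →L[ℝ] ℝ).smulRight (v : Cm m × (ℂ →L[ℂ] ℂ)))) t :=
    hasMFDerivAt_iff_hasFDerivAt.1 h1
  refine h2.hasDerivAt.congr_deriv ?_
  rw [← hv.fibreCoord_deriv hs hA hZ]
  exact congrArg Z (one_smul ℝ (v : Cm m × (ℂ →L[ℂ] ℂ)))

end Evaluation

/-- The solution of a scalar linear differential equation. -/
lemma eq_exp_mul_of_hasDerivAt {a Z : ℝ → ℂ} {t₀ ε : ℝ}
    (ha : ContinuousOn a (Metric.ball t₀ ε))
    (hZ : ∀ τ ∈ Metric.ball t₀ ε, HasDerivAt Z (-a τ * Z τ) τ) {t t' : ℝ}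
    (ht : t ∈ Metric.ball t₀ ε) (ht' : t' ∈ Metric.ball t₀ ε) :
    Z t' = Complex.exp (-∫ r in t..t', a r) * Z t := by
  have hsub : ∀ τ ∈ Metric.ball t₀ ε, uIcc t τ ⊆ Metric.ball t₀ ε := fun τ hτ =>
    (convex_ball t₀ ε).ordConnected.uIcc_subset ht hτ
  have hF : ∀ τ ∈ Metric.ball t₀ ε,
      HasDerivAt (fun τ => Complex.exp (∫ r in t..τ, a r) * Z τ) 0 τ := by
    intro τ hτ
    have h1 : HasDerivAt (fun τ => ∫ r in t..τ, a r) (a τ) τ :=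
      intervalIntegral.integral_hasDerivAt_right
        ((ha.mono (hsub τ hτ)).intervalIntegrable)
        (ha.stronglyMeasurableAtFilter Metric.isOpen_ball τ hτ)
        (ha.continuousAt (Metric.isOpen_ball.mem_nhds hτ))
    exact (h1.cexp.mul (hZ τ hτ)).congr_deriv (by ring)
  have hconst := Metric.isOpen_ball.is_const_of_deriv_eq_zero
    (convex_ball t₀ ε).isPreconnected
    (fun τ hτ => (hF τ hτ).differentiableAt.differentiableWithinAt)
    (fun τ hτ => (hF τ hτ).deriv) ht' ht
  simp only [intervalIntegral.integral_same, Complex.exp_zero, one_mul] at hconst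
  rw [← hconst, ← mul_assoc, ← Complex.exp_add]
  simp

/-! ### Uniqueness of flow lines and projection of the contact flow to the base. -/

section Flow

set_option linter.unusedSectionVars false

variable {m : ℕ} {M : Type*} [TopologicalSpace M] [T2Space M] [ChartedSpace (Cm m) M]
  [IsManifold 𝓘(ℂ, Cm m) ω M]
  {L : M → Type*} [TopologicalSpace (Bundle.TotalSpace ℂ L)]
  [∀ x, NormedAddCommGroup (L x)] [∀ x, InnerProductSpace ℂ (L x)]
  [FiberBundle ℂ L] [VectorBundle ℂ ℂ L] [ContMDiffVectorBundle ω ℂ L 𝓘(ℂ, Cm m)]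
  {ξ : ∀ x : M, TangentSpace 𝓘(ℝ, Cm m) x} {g : Flow ℝ M}

lemma IsSmoothFlowOf.hasMFDerivAt (hg : IsSmoothFlowOf ξ g) (x : M) (t : ℝ) :
    HasMFDerivAt 𝓘(ℝ, ℝ) 𝓘(ℝ, Cm m) (fun t => g t x) t
      ((1 : ℝ →L[ℝ] ℝ).smulRight (ξ (g t x) : Cm m)) := hg.2 x t

lemma flow_neg_cancel (g : Flow ℝ M) (t : ℝ) (x : M) : g (-t) (g t x) = x := by
  rw [← g.map_add, neg_add_cancel, g.map_zero_apply]

lemma flow_cancel_neg (g : Flow ℝ M) (t : ℝ) (x : M) : g t (g (-t) x) = x := by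
  rw [← g.map_add, add_neg_cancel, g.map_zero_apply]

/-- Integral curves of the generator of a smooth flow are flow lines. -/
lemma IsSmoothFlowOf.eq_of_isMIntegralCurve (hg : IsSmoothFlowOf ξ g) {c : ℝ → M}
    (hc : ∀ t, HasMFDerivAt 𝓘(ℝ, ℝ) 𝓘(ℝ, Cm m) c t
      ((1 : ℝ →L[ℝ] ℝ).smulRight (ξ (c t) : Cm m))) (t : ℝ) : c t = g t (c 0) := by
  have : IsManifold 𝓘(ℝ, Cm m) ∞ M := isManifold_real M
  have : IsManifold 𝓘(ℝ, Cm m) 1 M := IsManifold.of_le (n := ∞) (by simp)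
  have hneg : ∀ τ : ℝ, HasMFDerivAt 𝓘(ℝ, ℝ) 𝓘(ℝ, ℝ) (fun τ : ℝ => -τ) τ
      (-(1 : ℝ →L[ℝ] ℝ)) := fun τ => (hasFDerivAt_id τ).neg.hasMFDerivAt
  -- The derivative of `(τ, y) ↦ g(-τ, y)` in the direction `(1, ξ y)` vanishes: every `y` lies on a
  -- flow line `g τ x`, along which `g (-τ) (g τ x) = x` is constant.
  have key : ∀ (τ : ℝ) (y : M) (D : ℝ × Cm m →L[ℝ] Cm m),
      HasMFDerivAt (𝓘(ℝ, ℝ).prod 𝓘(ℝ, Cm m)) 𝓘(ℝ, Cm m) (fun p : ℝ × M => g p.1 p.2) (-τ, y) D →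
      D.comp ((-(1 : ℝ →L[ℝ] ℝ)).prod ((1 : ℝ →L[ℝ] ℝ).smulRight (ξ y : Cm m))) = 0 := by
    intro τ y D hD
    obtain ⟨x, rfl⟩ : ∃ x, g τ x = y := ⟨g (-τ) y, flow_cancel_neg g τ y⟩
    have h1 := (hneg τ).prodMk (hg.hasMFDerivAt x τ)
    have h2 : HasMFDerivAt 𝓘(ℝ, ℝ) 𝓘(ℝ, Cm m) (fun τ => g (-τ) (g τ x)) τ
        (D.comp ((-(1 : ℝ →L[ℝ] ℝ)).prod ((1 : ℝ →L[ℝ] ℝ).smulRight (ξ (g τ x) : Cm m)))) :=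
      HasMFDerivAt.comp (g := fun p : ℝ × M => g p.1 p.2) (f := fun τ => (-τ, g τ x)) τ hD h1
    have h3 : HasMFDerivAt 𝓘(ℝ, ℝ) 𝓘(ℝ, Cm m) (fun τ => g (-τ) (g τ x)) τ
        (0 : ℝ →L[ℝ] Cm m) :=
      HasMFDerivAt.congr_of_eventuallyEq (hasMFDerivAt_const x τ)
        (Eventually.of_forall fun τ => flow_neg_cancel g τ x)
    exact hasMFDerivAt_unique h2 h3
  have hd : ∀ τ, HasMFDerivAt 𝓘(ℝ, ℝ) 𝓘(ℝ, Cm m) (fun τ => g (-τ) (c τ)) τ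
      (0 : ℝ →L[ℝ] Cm m) := by
    intro τ
    let D : ℝ × Cm m →L[ℝ] Cm m := mfderiv (𝓘(ℝ, ℝ).prod 𝓘(ℝ, Cm m)) 𝓘(ℝ, Cm m)
      (fun p : ℝ × M => g p.1 p.2) (-τ, c τ)
    have hD : HasMFDerivAt (𝓘(ℝ, ℝ).prod 𝓘(ℝ, Cm m)) 𝓘(ℝ, Cm m)
        (fun p : ℝ × M => g p.1 p.2) (-τ, c τ) D :=
      ((hg.1 (-τ, c τ)).mdifferentiableAt (by simp)).hasMFDerivAt
    have h2 : HasMFDerivAt 𝓘(ℝ, ℝ) 𝓘(ℝ, Cm m) (fun τ => g (-τ) (c τ)) τ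
        (D.comp ((-(1 : ℝ →L[ℝ] ℝ)).prod ((1 : ℝ →L[ℝ] ℝ).smulRight (ξ (c τ) : Cm m)))) :=
      HasMFDerivAt.comp (g := fun p : ℝ × M => g p.1 p.2) (f := fun τ => (-τ, c τ)) τ hD
        ((hneg τ).prodMk (hc τ))
    exact h2.congr_mfderiv (key τ (c τ) D hD)
  have hz : (0 : ℝ →L[ℝ] Cm m) = (1 : ℝ →L[ℝ] ℝ).smulRight (0 : Cm m) := by
    ext1; simp
  -- Zero velocity gives constancy through uniqueness of integral curves for the zero field. That
  -- field is smooth for free, whereas no smoothness of `ξ` is assumed.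
  have hconst : (fun τ => g (-τ) (c τ)) = fun _ => c 0 := by
    refine isMIntegralCurve_Ioo_eq_of_contMDiff_boundaryless (I := 𝓘(ℝ, Cm m)) (t₀ := 0)
      (v := fun x => (0 : TangentSpace 𝓘(ℝ, Cm m) x))
      (Bundle.contMDiff_zeroSection ℝ (TangentSpace 𝓘(ℝ, Cm m) : M → Type _)) ?_ ?_ ?_
    · exact fun τ => (hd τ).congr_mfderiv hz
    · exact fun τ => HasMFDerivAt.congr_mfderiv (hasMFDerivAt_const (c 0) τ) hz
    · simp [g.map_zero_apply]
  have h0 : g (-t) (c t) = c 0 := congrFun hconst t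
  rw [← h0, flow_cancel_neg]

/-- Because `π_* ξ̂_H = ξ`, the projected curve is an integral curve of `ξ`. -/
lemma IsContactFlow.base_eq {H : M → ℝ} {G : Flow ℝ (CircleBundle L)}
    (hG : IsContactFlow L H ξ G) (hg : IsSmoothFlowOf ξ g) (p : CircleBundle L) (t : ℝ) :
    (G t p).base = g t p.base := by
  have h0 : p.base = (G 0 p).base := by rw [G.map_zero_apply]
  rw [h0]
  refine hg.eq_of_isMIntegralCurve (c := fun t => (G t p).base) (fun τ => ?_) t
  obtain ⟨v, hv, hder⟩ := hG p τ
  have hP : MDifferentiableAt (dualModel m) 𝓘(ℝ, Cm m)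
      (Bundle.TotalSpace.proj : DualTotal L → M) (G τ p).1 :=
    (contMDiffAt_restrictScalars (I := 𝓘(ℂ, Cm m).prod 𝓘(ℂ, ℂ →L[ℂ] ℂ)) (J := 𝓘(ℂ, Cm m))
      rfl rfl (Bundle.contMDiffAt_proj (n := ω) (Dual L))).mdifferentiableAt (by simp)
  let P : Cm m × (ℂ →L[ℂ] ℂ) →L[ℝ] Cm m :=
    mfderiv (dualModel m) 𝓘(ℝ, Cm m) (Bundle.TotalSpace.proj : DualTotal L → M) (G τ p).1
  let w : Cm m × (ℂ →L[ℂ] ℂ) := v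
  have h1 : HasMFDerivAt 𝓘(ℝ, ℝ) 𝓘(ℝ, Cm m) (fun t => (G t p).base) τ
      (P.comp ((1 : ℝ →L[ℝ] ℝ).smulRight w)) :=
    HasMFDerivAt.comp (g := (Bundle.TotalSpace.proj : DualTotal L → M))
      (f := fun s => (G s p).1) τ hP.hasMFDerivAt hder
  have h2 : P.comp ((1 : ℝ →L[ℝ] ℝ).smulRight w) = (1 : ℝ →L[ℝ] ℝ).smulRight (P w) := by
    ext1; simp
  have h3 : P w = (ξ (G τ p).base : Cm m) := hv.1
  rw [h3] at h2
  exact h1.congr_mfderiv h2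

end Flow

/-! ### The multiplier of the contact flow and its logarithmic derivative. -/

section Transport

set_option linter.unusedSectionVars false

variable {m : ℕ} {M : Type*} [TopologicalSpace M] [T2Space M] [ChartedSpace (Cm m) M]
  [IsManifold 𝓘(ℂ, Cm m) ω M]
  {L : M → Type*} [TopologicalSpace (Bundle.TotalSpace ℂ L)]
  [∀ x, NormedAddCommGroup (L x)] [∀ x, InnerProductSpace ℂ (L x)]
  [FiberBundle ℂ L] [VectorBundle ℂ ℂ L] [ContMDiffVectorBundle ω ℂ L 𝓘(ℂ, Cm m)]
  {ξ : ∀ x : M, TangentSpace 𝓘(ℝ, Cm m) x} {g : Flow ℝ M}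
  {H : M → ℝ} {G : Flow ℝ (CircleBundle L)} {κ : OpenPartialHomeomorph M (Cm m)}

/-- The pull back of the form `∂φ` by a map `y`. -/
def pullDel (φ : M → ℝ) (y : Cm m → M) (w : Cm m) : Cm m →L[ℝ] ℂ :=
  let A : Cm m →L[ℝ] ℝ := mfderiv 𝓘(ℝ, Cm m) 𝓘(ℝ, ℝ) φ (y w)
  let Y : Cm m →L[ℝ] Cm m := mfderiv 𝓘(ℝ, Cm m) 𝓘(ℝ, Cm m) y w
  (delPart (Cm m) A).comp Y

lemma pullDel_eq {φ : M → ℝ} {y : Cm m → M} {w : Cm m}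
    {A : Cm m →L[ℝ] ℝ} {Y : Cm m →L[ℝ] Cm m}
    (hA : HasMFDerivAt 𝓘(ℝ, Cm m) 𝓘(ℝ, ℝ) φ (y w) A)
    (hY : HasMFDerivAt 𝓘(ℝ, Cm m) 𝓘(ℝ, Cm m) y w Y) :
    pullDel φ y w = (delPart (Cm m) A).comp Y := by
  simp only [pullDel, hA.mfderiv, hY.mfderiv]

lemma pullDel_eq_chart {χ : OpenPartialHomeomorph M (Cm m)}
    (hχ : χ ∈ IsManifold.maximalAtlas 𝓘(ℂ, Cm m) ω M) {φ : M → ℝ} {y : Cm m → M} {w : Cm m}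
    (hw : y w ∈ χ.source) (hφ : MDifferentiableAt 𝓘(ℝ, Cm m) 𝓘(ℝ, ℝ) φ (y w))
    (hy : MDifferentiableAt 𝓘(ℝ, Cm m) 𝓘(ℝ, Cm m) y w) :
    pullDel φ y w =
      (delPart (Cm m) (fderiv ℝ (φ ∘ χ.symm) (χ (y w)))).comp (fderiv ℝ (χ ∘ y) w) :=
  delPart_comp_eq_of_mem_maximalAtlas hχ hw hφ.hasMFDerivAt hy.hasMFDerivAt

/-- Near the centre of `κ`, the contact flow at time `t` acts on the fibres, in the frames `e` and
`s`, by multiplication with a function whose logarithmic derivative is the difference of the forms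
`∂φ_e` and `∂φ_s` pulled back to the coordinate domain. -/
def HasTransport (κ : OpenPartialHomeomorph M (Cm m)) (g : Flow ℝ M) (G : Flow ℝ (CircleBundle L))
    (e : ∀ x, L x) (t : ℝ) (s : ∀ x, L x) : Prop :=
  ∃ U : Cm m → ℂ, ∀ᶠ w in 𝓝 (0 : Cm m), U w ≠ 0 ∧
    (∀ p : CircleBundle L, p.base = κ.symm w →
      fibreCoord s (G t p).1 = U w * fibreCoord e p.1) ∧
    HasFDerivAt U (U w • (pullDel (potential e) κ.symm w
      - pullDel (potential s) (fun w => g t (κ.symm w)) w)) w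

lemma contMDiffAt_flow_chart (hg : IsSmoothFlowOf ξ g)
    (hκ : κ ∈ IsManifold.maximalAtlas 𝓘(ℂ, Cm m) ω M) {t : ℝ} {w : Cm m} (hw : w ∈ κ.target) :
    ContMDiffAt (𝓘(ℝ, ℝ).prod 𝓘(ℝ, Cm m)) 𝓘(ℝ, Cm m) ∞
      (fun q : ℝ × Cm m => g q.1 (κ.symm q.2)) (t, w) := by
  have h1 : ContMDiffAt (𝓘(ℝ, ℝ).prod 𝓘(ℝ, Cm m)) 𝓘(ℝ, Cm m) ∞
      (fun q : ℝ × Cm m => κ.symm q.2) (t, w) :=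
    ContMDiffAt.comp (g := κ.symm) (f := Prod.snd) (t, w)
      (contMDiffAt_real_symm_of_mem_maximalAtlas hκ hw) contMDiffAt_snd
  exact ContMDiffAt.comp (g := fun p : ℝ × M => g p.1 p.2)
    (f := fun q : ℝ × Cm m => (q.1, κ.symm q.2)) (t, w) (hg.1 _) (contMDiffAt_fst.prodMk h1)

lemma contMDiffAt_flow_chart_right (hg : IsSmoothFlowOf ξ g)
    (hκ : κ ∈ IsManifold.maximalAtlas 𝓘(ℂ, Cm m) ω M) (t : ℝ) {w : Cm m} (hw : w ∈ κ.target) :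
    ContMDiffAt 𝓘(ℝ, Cm m) 𝓘(ℝ, Cm m) ∞ (fun w => g t (κ.symm w)) w :=
  ContMDiffAt.comp (g := fun q : ℝ × Cm m => g q.1 (κ.symm q.2)) (f := fun w => (t, w)) w
    (contMDiffAt_flow_chart hg hκ hw) (contMDiffAt_const.prodMk contMDiffAt_id)

lemma hasTransport_zero (e : ∀ x, L x) : HasTransport κ g G e 0 e := by
  refine ⟨fun _ => 1, Eventually.of_forall fun w => ⟨one_ne_zero, fun p _ => ?_, ?_⟩⟩
  · rw [G.map_zero_apply, one_mul]
  · simp only [g.map_zero_apply, sub_self, smul_zero]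
    exact hasFDerivAt_const _ _

/-- The new multiplier is `(f ∘ gᵗ) U`; the pull back of `df / f` in its logarithmic derivative is
what `∂φ_s` loses on passing to `s' = f s`. -/
lemma HasTransport.change_frame (hh : IsSmoothHermitianMetric (m := m) L)
    (hg : IsSmoothFlowOf ξ g) (hG : IsContactFlow L H ξ G)
    (hκ : κ ∈ IsManifold.maximalAtlas 𝓘(ℂ, Cm m) ω M) (h0 : (0 : Cm m) ∈ κ.target)
    {e s s' : ∀ x, L x} {t : ℝ} (h : HasTransport κ g G e t s)
    (hs : IsHolomorphicFrameAt m s (g t (κ.symm 0)))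
    (hs' : IsHolomorphicFrameAt m s' (g t (κ.symm 0))) : HasTransport κ g G e t s' := by
  obtain ⟨U, hU⟩ := h
  obtain ⟨f, hf⟩ := hs.exists_ratio hs'
  have hcont : Tendsto (fun w => g t (κ.symm w)) (𝓝 0) (𝓝 (g t (κ.symm 0))) :=
    (contMDiffAt_flow_chart_right hg hκ t h0).continuousAt
  refine ⟨fun w => f (g t (κ.symm w)) * U w, ?_⟩
  filter_upwards [hU, hcont.eventually hs.eventually, hcont.eventually hs'.eventually,
    hcont.eventually (eventually_eventually_nhds.2 hf), κ.open_target.mem_nhds h0]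
    with w hw hsw hs'w hfw hwκ
  obtain ⟨hfC, hf0, -⟩ := hfw.self_of_nhds
  refine ⟨mul_ne_zero hf0 hw.1, fun p hp => ?_, ?_⟩
  · have hb : (G t p).1.1 = g t (κ.symm w) := by rw [← hp]; exact hG.base_eq hg p t
    have h1 : s' (G t p).1.1 = f (G t p).1.1 • s (G t p).1.1 := by
      rw [hb]; exact hfw.self_of_nhds.2.2
    have h2 : fibreCoord s' (G t p).1 = f (G t p).1.1 * fibreCoord s (G t p).1 := by
      rw [fibreCoord, h1, map_smul, smul_eq_mul]; rfl
    rw [h2, hw.2.1 p hp, hb, mul_assoc]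
  · have hy := (contMDiffAt_flow_chart_right hg hκ t hwκ).mdifferentiableAt (by simp)
    let Y : Cm m →L[ℝ] Cm m := mfderiv 𝓘(ℝ, Cm m) 𝓘(ℝ, Cm m) (fun w => g t (κ.symm w)) w
    have hY : HasMFDerivAt 𝓘(ℝ, Cm m) 𝓘(ℝ, Cm m) (fun w => g t (κ.symm w)) w Y :=
      hy.hasMFDerivAt
    let A : Cm m →L[ℝ] ℝ := mfderiv 𝓘(ℝ, Cm m) 𝓘(ℝ, ℝ) (potential s) (g t (κ.symm w))
    have hA : HasMFDerivAt 𝓘(ℝ, Cm m) 𝓘(ℝ, ℝ) (potential s) (g t (κ.symm w)) A :=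
      ((hsw.contMDiffAt_potential hh).mdifferentiableAt (by simp)).hasMFDerivAt
    let A' : Cm m →L[ℝ] ℝ := mfderiv 𝓘(ℝ, Cm m) 𝓘(ℝ, ℝ) (potential s') (g t (κ.symm w))
    have hA' : HasMFDerivAt 𝓘(ℝ, Cm m) 𝓘(ℝ, ℝ) (potential s') (g t (κ.symm w)) A' :=
      ((hs'w.contMDiffAt_potential hh).mdifferentiableAt (by simp)).hasMFDerivAt
    let f' : Cm m →L[ℝ] ℂ := mfderiv 𝓘(ℝ, Cm m) 𝓘(ℝ, ℂ) f (g t (κ.symm w))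
    have hf' : HasMFDerivAt 𝓘(ℝ, Cm m) 𝓘(ℝ, ℂ) f (g t (κ.symm w)) f' :=
      ((contMDiffAt_restrictScalars (I := 𝓘(ℂ, Cm m)) (J := 𝓘(ℂ, ℂ)) rfl rfl
        hfC).mdifferentiableAt (by simp)).hasMFDerivAt
    have hrel := delPart_potential_smul (hsw.and hfw |>.mono fun y hy => ⟨hy.1.2, hy.2.2⟩)
      (hfC.mdifferentiableAt (by simp)) hA hA' hf'
    have hF : HasFDerivAt (fun w => f (g t (κ.symm w))) (f'.comp Y) w := by
      have h1 : HasMFDerivAt 𝓘(ℝ, Cm m) 𝓘(ℝ, ℂ) (fun w => f (g t (κ.symm w))) w (f'.comp Y) :=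
        HasMFDerivAt.comp (g := f) (f := fun w => g t (κ.symm w)) w hf' hY
      exact hasMFDerivAt_iff_hasFDerivAt.1 h1
    rw [pullDel_eq hA' hY, hrel]
    have hU' := hw.2.2
    rw [pullDel_eq hA hY] at hU'
    refine (hF.mul hU').congr_fderiv ?_
    ext v
    simp only [add_apply, smul_apply, sub_apply, ContinuousLinearMap.comp_apply, smul_eq_mul]
    field_simp
    ring

/-- The identity `dH = ι_ξ i∂∂̄φ` in a holomorphic chart and frame. -/
lemma hamiltonian_in_chart (hh : IsSmoothHermitianMetric (m := m) L)
    (hH : ContMDiff 𝓘(ℝ, Cm m) 𝓘(ℝ, ℝ) ∞ H) (hξ : IsHamiltonianVectorField L H ξ)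
    {χ : OpenPartialHomeomorph M (Cm m)} (hχ : χ ∈ IsManifold.maximalAtlas 𝓘(ℂ, Cm m) ω M)
    {x : M} (hx : x ∈ χ.source) {s : ∀ x, L x} (hs : IsHolomorphicFrameAt m s x)
    {C : Cm m →L[ℝ] Cm m} (hC : HasMFDerivAt 𝓘(ℝ, Cm m) 𝓘(ℝ, Cm m) χ x C) (u : Cm m) :
    fderiv ℝ (fderiv ℝ (potential s ∘ χ.symm)) (χ x) u (Complex.I • C (ξ x))
      - fderiv ℝ (fderiv ℝ (potential s ∘ χ.symm)) (χ x) (C (ξ x)) (Complex.I • u)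
      = 2 * fderiv ℝ (H ∘ χ.symm) (χ x) u := by
  have hs1 := contMDiffAt_real_symm_of_mem_maximalAtlas hχ (χ.map_source hx)
  let S : Cm m →L[ℝ] Cm m := mfderiv 𝓘(ℝ, Cm m) 𝓘(ℝ, Cm m) χ.symm (χ x)
  have hS : HasMFDerivAt 𝓘(ℝ, Cm m) 𝓘(ℝ, Cm m) χ.symm (χ x) S :=
    (hs1.mdifferentiableAt (by simp)).hasMFDerivAt
  let B : Cm m →L[ℝ] ℝ := mfderiv 𝓘(ℝ, Cm m) 𝓘(ℝ, ℝ) H x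
  have hB : HasMFDerivAt 𝓘(ℝ, Cm m) 𝓘(ℝ, ℝ) H (χ.symm (χ x)) B := by
    rw [χ.left_inv hx]; exact ((hH x).mdifferentiableAt (by simp)).hasMFDerivAt
  have hC' : HasMFDerivAt 𝓘(ℝ, Cm m) 𝓘(ℝ, Cm m) χ (χ.symm (χ x)) C := by
    rwa [χ.left_inv hx]
  have hCS : C.comp S = ContinuousLinearMap.id ℝ (Cm m) := by
    have h1 : HasMFDerivAt 𝓘(ℝ, Cm m) 𝓘(ℝ, Cm m) (χ ∘ χ.symm) (χ x) (C.comp S) := hC'.comp _ hS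
    have h2 : HasMFDerivAt 𝓘(ℝ, Cm m) 𝓘(ℝ, Cm m) (χ ∘ χ.symm) (χ x)
        (ContinuousLinearMap.id ℝ (Cm m)) := by
      refine (hasMFDerivAt_id (χ x)).congr_of_eventuallyEq ?_
      filter_upwards [χ.open_target.mem_nhds (χ.map_source hx)] with y hy using χ.right_inv hy
    exact hasMFDerivAt_unique h1 h2
  have hdH : fderiv ℝ (H ∘ χ.symm) (χ x) = B.comp S := by
    have h1 : HasMFDerivAt 𝓘(ℝ, Cm m) 𝓘(ℝ, ℝ) (H ∘ χ.symm) (χ x) (B.comp S) := hB.comp _ hS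
    have h2 : HasFDerivAt (H ∘ χ.symm) (B.comp S) (χ x) := hasMFDerivAt_iff_hasFDerivAt.1 h1
    exact h2.fderiv
  have hu : C (S u) = u := congrArg (fun A : Cm m →L[ℝ] Cm m => A u) hCS
  have h1 := curvatureForm_eq_iddbar hh hχ hx hs hC (ξ x) (S u)
  have h2 : curvatureForm (m := m) L x (ξ x) (S u) = B (S u) := hξ x (S u)
  rw [h2, iddbar, hu] at h1
  rw [hdH, ContinuousLinearMap.comp_apply, h1]
  ring

/-- For times near `t₀` the orbits of points near the centre stay in one chart and in the domain of
`s`, so a multiplier at `t` is continued to `t'` by the factor `exp(-∫ a)`. The radius does not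
depend on the choice of `t` and `t'`, and their roles are symmetric; openness and closedness both
follow. -/
lemma exists_hasTransport_iff_ball (hh : IsSmoothHermitianMetric (m := m) L)
    (hH : ContMDiff 𝓘(ℝ, Cm m) 𝓘(ℝ, ℝ) ∞ H) (hξ : IsHamiltonianVectorField L H ξ)
    (hg : IsSmoothFlowOf ξ g) (hG : IsContactFlow L H ξ G)
    (hκ : κ ∈ IsManifold.maximalAtlas 𝓘(ℂ, Cm m) ω M) (h0 : (0 : Cm m) ∈ κ.target)
    (e : ∀ x, L x) {s : ∀ x, L x} {t₀ : ℝ}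
    (hs : IsHolomorphicFrameAt m s (g t₀ (κ.symm 0))) :
    ∃ ε > 0, (∀ t ∈ Metric.ball t₀ ε, IsHolomorphicFrameAt m s (g t (κ.symm 0))) ∧
      ∀ t ∈ Metric.ball t₀ ε, ∀ t' ∈ Metric.ball t₀ ε,
        HasTransport κ g G e t s → HasTransport κ g G e t' s := by
  set χ := chartAt (Cm m) (g t₀ (κ.symm 0)) with hχdef
  have hχ : χ ∈ IsManifold.maximalAtlas 𝓘(ℂ, Cm m) ω M := IsManifold.chart_mem_maximalAtlas _
  set Y : ℝ × Cm m → M := fun q => g q.1 (κ.symm q.2) with hY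
  have hYc : ContinuousAt Y (t₀, 0) := (contMDiffAt_flow_chart hg hκ h0).continuousAt
  have hev : ∀ᶠ q in 𝓝 (t₀, (0 : Cm m)), q.2 ∈ κ.target ∧ Y q ∈ χ.source ∧
      IsHolomorphicFrameAt m s (Y q) := by
    refine ((continuous_snd.tendsto (t₀, (0 : Cm m))).eventually
      (κ.open_target.mem_nhds h0)).and ((hYc.eventually
        (χ.open_source.mem_nhds (mem_chart_source _ _))).and (hYc.eventually hs.eventually))
  rw [nhds_prod_eq, Filter.eventually_prod_iff] at hev
  obtain ⟨pa, hpa, pb, hpb, hQ⟩ := hev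
  obtain ⟨ε, hε, hball⟩ := Metric.eventually_nhds_iff_ball.1 hpa
  have hQ' : ∀ t ∈ Metric.ball t₀ ε, ∀ w, pb w → w ∈ κ.target ∧ Y (t, w) ∈ χ.source ∧
      IsHolomorphicFrameAt m s (Y (t, w)) := fun t ht w hw => hQ (hball t ht) hw
  refine ⟨ε, hε, fun t ht => (hQ' t ht 0 hpb.self_of_nhds).2.2, ?_⟩
  rintro t ht t' ht' ⟨U, hU⟩
  set φ := potential s ∘ χ.symm with hφdef
  set h := H ∘ χ.symm with hhdef
  set γ : ℝ × Cm m → Cm m := χ ∘ Y with hγdef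
  -- The coefficient `iH + ∂φ(ξ)` of the fibre equation, written in the chart along the orbits `γ`.
  set a : ℝ × Cm m → ℂ := fun q => Complex.I * (h (γ q) : ℂ)
    + delPart (Cm m) (fderiv ℝ φ (γ q)) (fderiv ℝ γ q (1, 0)) with hadef
  have hsub : uIcc t t' ⊆ Metric.ball t₀ ε := (convex_ball t₀ ε).ordConnected.uIcc_subset ht ht'
  have hsm : ∀ τ ∈ Metric.ball t₀ ε, ∀ w, pb w → ContDiffAt ℝ ∞ γ (τ, w) ∧
      ContDiffAt ℝ ∞ φ (γ (τ, w)) ∧ ContDiffAt ℝ ∞ h (γ (τ, w)) := by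
    intro τ hτ w hw
    obtain ⟨hwκ, hx, hsx⟩ := hQ' τ hτ w hw
    have hsymm := contMDiffAt_real_symm_of_mem_maximalAtlas hχ (χ.map_source hx)
    refine ⟨?_, ?_, ?_⟩
    · have h1 : ContMDiffAt (𝓘(ℝ, ℝ).prod 𝓘(ℝ, Cm m)) 𝓘(ℝ, Cm m) ∞ γ (τ, w) :=
        ContMDiffAt.comp (g := χ) (f := Y) (τ, w) (contMDiffAt_real_of_mem_maximalAtlas hχ hx)
          (contMDiffAt_flow_chart hg hκ hwκ)
      rw [← modelWithCornersSelf_prod] at h1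
      exact contMDiffAt_iff_contDiffAt.1 (by rwa [← chartedSpaceSelf_prod])
    · refine ContMDiffAt.contDiffAt (ContMDiffAt.comp (g := potential s) _ ?_ hsymm)
      have h1 : χ.symm (γ (τ, w)) = Y (τ, w) := χ.left_inv hx
      rw [h1]; exact hsx.contMDiffAt_potential hh
    · exact ContMDiffAt.contDiffAt (ContMDiffAt.comp (g := H) _ (hH _) hsymm)
  have hvel : ∀ τ ∈ Metric.ball t₀ ε, ∀ w, pb w → ∀ C : Cm m →L[ℝ] Cm m,
      HasMFDerivAt 𝓘(ℝ, Cm m) 𝓘(ℝ, Cm m) χ (Y (τ, w)) C →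
      fderiv ℝ γ (τ, w) (1, 0) = C (ξ (Y (τ, w))) := by
    intro τ hτ w hw C hC
    have h1 : HasMFDerivAt 𝓘(ℝ, ℝ) 𝓘(ℝ, Cm m) (fun r => γ (r, w)) τ
        (C.comp ((1 : ℝ →L[ℝ] ℝ).smulRight (ξ (Y (τ, w)) : Cm m))) :=
      HasMFDerivAt.comp (g := χ) (f := fun r => g r (κ.symm w)) τ hC
        (hg.hasMFDerivAt (κ.symm w) τ)
    have h2 : HasFDerivAt (fun r => γ (r, w))
        (C.comp ((1 : ℝ →L[ℝ] ℝ).smulRight (ξ (Y (τ, w)) : Cm m))) τ :=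
      hasMFDerivAt_iff_hasFDerivAt.1 h1
    have h3 : HasDerivAt (fun r : ℝ => γ (r, w)) (fderiv ℝ γ (τ, w) (1, 0)) τ :=
      (((hsm τ hτ w hw).1.differentiableAt (by simp)).hasFDerivAt).comp_hasDerivAt τ
        ((hasDerivAt_id τ).prodMk (hasDerivAt_const τ w))
    have h4 := h2.hasDerivAt.unique h3
    rw [← h4]
    exact congrArg C (one_smul ℝ (ξ (Y (τ, w)) : Cm m))
  have hchart : ∀ τ ∈ Metric.ball t₀ ε, ∀ w, pb w → ∃ C : Cm m →L[ℝ] Cm m,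
      HasMFDerivAt 𝓘(ℝ, Cm m) 𝓘(ℝ, Cm m) χ (Y (τ, w)) C := fun τ hτ w hw =>
    ⟨mfderiv 𝓘(ℝ, Cm m) 𝓘(ℝ, Cm m) χ (Y (τ, w)),
      ((contMDiffAt_real_of_mem_maximalAtlas hχ (hQ' τ hτ w hw).2.1).mdifferentiableAt
        (by simp)).hasMFDerivAt⟩
  refine ⟨fun w => U w * Complex.exp (-∫ τ in t..t', a (τ, w)), ?_⟩
  filter_upwards [hU, hpb] with w hUw hw
  have hint : HasFDerivAt (fun w => ∫ τ in t..t', a (τ, w))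
      ((delPart (Cm m) (fderiv ℝ φ (γ (t', w)))).comp
          ((fderiv ℝ γ (t', w)).comp (ContinuousLinearMap.inr ℝ ℝ (Cm m)))
        - (delPart (Cm m) (fderiv ℝ φ (γ (t, w)))).comp
          ((fderiv ℝ γ (t, w)).comp (ContinuousLinearMap.inr ℝ ℝ (Cm m)))) w := by
    refine hasFDerivAt_integral_lagrangian (fun τ hτ => (hsm τ (hsub hτ) w hw).1)
      (fun τ hτ => (hsm τ (hsub hτ) w hw).2.1) (fun τ hτ => (hsm τ (hsub hτ) w hw).2.2) ?_
    intro τ hτ u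
    obtain ⟨C, hC⟩ := hchart τ (hsub hτ) w hw
    obtain ⟨-, hx, hsx⟩ := hQ' τ (hsub hτ) w hw
    rw [hvel τ (hsub hτ) w hw C hC]
    exact hamiltonian_in_chart hh hH hξ hχ hx hsx hC u
  have hpull : ∀ τ ∈ Metric.ball t₀ ε,
      pullDel (potential s) (fun w => g τ (κ.symm w)) w =
        (delPart (Cm m) (fderiv ℝ φ (γ (τ, w)))).comp
          ((fderiv ℝ γ (τ, w)).comp (ContinuousLinearMap.inr ℝ ℝ (Cm m))) := by
    intro τ hτ
    obtain ⟨hwκ, hx, hsx⟩ := hQ' τ hτ w hw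
    rw [pullDel_eq_chart hχ (y := fun w => g τ (κ.symm w)) hx
      ((hsx.contMDiffAt_potential hh).mdifferentiableAt (by simp))
      ((contMDiffAt_flow_chart_right hg hκ τ hwκ).mdifferentiableAt (by simp))]
    congr 1
    have h1 : HasFDerivAt (fun w => γ (τ, w))
        ((fderiv ℝ γ (τ, w)).comp (ContinuousLinearMap.inr ℝ ℝ (Cm m))) w :=
      (((hsm τ hτ w hw).1.differentiableAt (by simp)).hasFDerivAt).comp w
        (hasFDerivAt_prodMk_right τ w)
    exact h1.fderiv
  refine ⟨mul_ne_zero hUw.1 (Complex.exp_ne_zero _), fun p hp => ?_, ?_⟩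
  · have hb : ∀ τ, (G τ p).base = Y (τ, w) := fun τ => by
      rw [hG.base_eq hg p τ, hp]
    have hode := eq_exp_mul_of_hasDerivAt (a := fun τ => a (τ, w))
      (Z := fun τ => fibreCoord s (G τ p).1) (t₀ := t₀) (ε := ε) ?_ ?_ ht ht'
    · change fibreCoord s (G t' p).1 = _ * fibreCoord s (G t p).1 at hode
      rw [hode, hUw.2.1 p hp]
      ring
    · intro τ hτ
      obtain ⟨c1, c2, c3⟩ := hsm τ hτ w hw
      have k1 : ContinuousAt (fun q => (h (γ q) : ℂ)) (τ, w) :=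
        Complex.continuous_ofReal.continuousAt.comp
          (ContinuousAt.comp (g := h) c3.continuousAt c1.continuousAt)
      have k2 : ContinuousAt (fun q => delPart (Cm m) (fderiv ℝ φ (γ q))) (τ, w) :=
        (delPart (Cm m)).continuous.continuousAt.comp (ContinuousAt.comp (g := fderiv ℝ φ)
          (c2.fderiv_right (m := 1) one_add_one_le_infty).continuousAt c1.continuousAt)
      have k3 : ContinuousAt (fun q => fderiv ℝ γ q (1, 0)) (τ, w) :=
        (c1.fderiv_right (m := 1) one_add_one_le_infty).continuousAt.clm_apply continuousAt_const
      have k4 : ContinuousAt a (τ, w) := (continuousAt_const.mul k1).add (k2.clm_apply k3)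
      exact (ContinuousAt.comp (g := a) (f := fun τ => (τ, w)) k4
        (by fun_prop)).continuousWithinAt
    · intro τ hτ
      obtain ⟨hwκ, hx, hsx⟩ := hQ' τ hτ w hw
      obtain ⟨C, hC⟩ := hchart τ hτ w hw
      let A : Cm m →L[ℝ] ℝ := mfderiv 𝓘(ℝ, Cm m) 𝓘(ℝ, ℝ) (potential s) (Y (τ, w))
      have hA : HasMFDerivAt 𝓘(ℝ, Cm m) 𝓘(ℝ, ℝ) (potential s) (Y (τ, w)) A :=
        ((hsx.contMDiffAt_potential hh).mdifferentiableAt (by simp)).hasMFDerivAt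
      have hsx' : IsHolomorphicFrameAt m s (G τ p).base := by rw [hb]; exact hsx
      have hA' : HasMFDerivAt 𝓘(ℝ, Cm m) 𝓘(ℝ, ℝ) (potential s) (G τ p).base A := by
        rw [hb]; exact hA
      refine (hG.hasDerivAt_fibreCoord p τ hsx' hA').congr_deriv ?_
      have key : Complex.I * (H (G τ p).base : ℂ) + delPart (Cm m) A (ξ (G τ p).base)
          = a (τ, w) := by
        have e1 := delPart_comp_eq_of_mem_maximalAtlas hχ (y := fun r => g r (κ.symm w)) (w := τ)
          hx hA (hg.hasMFDerivAt (κ.symm w) τ)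
        have e2 : HasDerivAt (fun r : ℝ => γ (r, w)) (fderiv ℝ γ (τ, w) (1, 0)) τ :=
          (((hsm τ hτ w hw).1.differentiableAt (by simp)).hasFDerivAt).comp_hasDerivAt τ
            ((hasDerivAt_id τ).prodMk (hasDerivAt_const τ w))
        have e3 := congrArg (fun B : ℝ →L[ℝ] ℂ => B 1) e1
        have e4 : delPart (Cm m) A (ξ (Y (τ, w))) = delPart (Cm m) (fderiv ℝ φ (γ (τ, w)))
            (fderiv ℝ γ (τ, w) (1, 0)) := by
          refine (congrArg (delPart (Cm m) A)
            (one_smul ℝ (ξ (Y (τ, w)) : Cm m))).symm.trans (e3.trans ?_)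
          refine congrArg (delPart (Cm m) (fderiv ℝ φ (γ (τ, w)))) ?_
          exact e2.deriv
        have e5 : H (Y (τ, w)) = h (γ (τ, w)) := by
          simp only [hhdef, hγdef, Function.comp_apply, χ.left_inv hx]
        rw [hb τ, e4, e5]
      rw [key]
  · have hUd := hUw.2.2
    rw [hpull t ht] at hUd
    rw [hpull t' ht']
    refine (hUd.mul hint.neg.cexp).congr_fderiv ?_
    ext v
    simp only [add_apply, smul_apply, sub_apply, neg_apply, smul_eq_mul, Pi.neg_apply]
    ring

/-- The contact flow acts on the fibres by transport functions, for all times. -/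
theorem hasTransport (hh : IsSmoothHermitianMetric (m := m) L)
    (hH : ContMDiff 𝓘(ℝ, Cm m) 𝓘(ℝ, ℝ) ∞ H) (hξ : IsHamiltonianVectorField L H ξ)
    (hg : IsSmoothFlowOf ξ g) (hG : IsContactFlow L H ξ G)
    (hκ : κ ∈ IsManifold.maximalAtlas 𝓘(ℂ, Cm m) ω M) (h0 : (0 : Cm m) ∈ κ.target)
    {e s : ∀ x, L x} (he : IsHolomorphicFrameAt m e (κ.symm 0)) {t : ℝ}
    (hs : IsHolomorphicFrameAt m s (g t (κ.symm 0))) : HasTransport κ g G e t s := by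
  let S : Set ℝ := {t | ∀ s : ∀ x, L x, IsHolomorphicFrameAt m s (g t (κ.symm 0)) →
    HasTransport κ g G e t s}
  -- Membership in `S` concerns all frames at once, so a local trivialization at each `t₀` may serve
  -- as intermediary. The symmetry in `t, t'` makes both `S` and its complement open.
  have hloc : ∀ t₀ : ℝ, ∃ ε > 0, ∀ t ∈ Metric.ball t₀ ε, ∀ t' ∈ Metric.ball t₀ ε,
      t ∈ S → t' ∈ S := by
    intro t₀
    have hs₀ : IsHolomorphicFrameAt m
        (fun y => (trivializationAt ℂ L (g t₀ (κ.symm 0))).symm y 1) (g t₀ (κ.symm 0)) :=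
      isHolomorphicFrameAt_trivializationAt _ (FiberBundle.mem_baseSet_trivializationAt' _)
    obtain ⟨ε, hε, h1, h2⟩ := exists_hasTransport_iff_ball hh hH hξ hg hG hκ h0 e hs₀
    exact ⟨ε, hε, fun t ht t' ht' htS s' hs' =>
      (h2 t ht t' ht' (htS _ (h1 t ht))).change_frame hh hg hG hκ h0 (h1 t' ht') hs'⟩
  have hopen : IsOpen S := by
    rw [Metric.isOpen_iff]
    intro t₀ ht₀
    obtain ⟨ε, hε, h⟩ := hloc t₀
    exact ⟨ε, hε, fun t' ht' => h t₀ (Metric.mem_ball_self hε) t' ht' ht₀⟩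
  have hclosed : IsClosed S := by
    rw [← isOpen_compl_iff, Metric.isOpen_iff]
    intro t₀ ht₀
    obtain ⟨ε, hε, h⟩ := hloc t₀
    exact ⟨ε, hε, fun t' ht' htS => ht₀ (h t' ht' t₀ (Metric.mem_ball_self hε) htS)⟩
  have hzero : (0 : ℝ) ∈ S := by
    intro s' hs'
    have he' : IsHolomorphicFrameAt m e (g 0 (κ.symm 0)) := by rwa [g.map_zero_apply]
    exact (hasTransport_zero e).change_frame hh hg hG hκ h0 he' hs'
  have huniv : S = univ := IsClopen.eq_univ ⟨hclosed, hopen⟩ ⟨0, hzero⟩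
  exact (huniv ▸ mem_univ t : t ∈ S) s hs

end Transport

/-! ### Jets at the fixed point: vanishing of the Hessian. -/

section Jets

variable {m : ℕ}

/-- A polynomial without monomials of degree less than `k` is `O(|w|^k)`. -/
lemma isBigO_eval_mvPolynomial {σ X : Type*} [Fintype σ] [NormedAddCommGroup X]
    (P : MvPolynomial σ ℂ) {k : ℕ} (hP : ∀ d ∈ P.support, k ≤ ∑ i, d i) {x : X → σ → ℂ}
    (hx : ∀ w i, ‖x w i‖ ≤ ‖w‖) :
    (fun w => MvPolynomial.eval (x w) P) =O[𝓝 (0 : X)] fun w => ‖w‖ ^ k := by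
  simp only [MvPolynomial.eval_eq']
  suffices ∀ d ∈ P.support, (fun w => P.coeff d * ∏ i, x w i ^ d i) =O[𝓝 (0 : X)]
      fun w => ‖w‖ ^ k from IsBigO.fun_sum this
  intro d hd
  refine IsBigO.of_bound ‖P.coeff d‖ ?_
  filter_upwards [Metric.closedBall_mem_nhds (0 : X) one_pos] with w hw
  have hw1 : ‖w‖ ≤ 1 := by simpa using hw
  rw [norm_mul, norm_prod, norm_pow, norm_norm]
  gcongr
  calc ∏ i, ‖x w i ^ d i‖ ≤ ∏ i, ‖w‖ ^ d i := by
        refine Finset.prod_le_prod (fun i _ => norm_nonneg _) fun i _ => ?_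
        rw [norm_pow]
        exact pow_le_pow_left₀ (norm_nonneg _) (hx w i) _
    _ = ‖w‖ ^ ∑ i, d i := by rw [Finset.prod_pow_eq_pow_sum]
    _ ≤ ‖w‖ ^ k := pow_le_pow_of_le_one (norm_nonneg _) hw1 (hP d hd)

lemma fderiv_norm_sq_Cm : fderiv ℝ (fun w : Cm m => ‖w‖ ^ 2) =
    fun w => (2 • innerSL ℝ : Cm m →L[ℝ] Cm m →L[ℝ] ℝ) w := by
  rw [fderiv_norm_sq]
  rfl

/-- Multiplication by `i` is skew for the real inner product. -/
lemma inner_I_smul_antisymm (u v : Cm m) :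
    (innerSL ℝ u (Complex.I • v) : ℝ) = -innerSL ℝ v (Complex.I • u) := by
  rw [innerSL_apply_apply, innerSL_apply_apply]
  simp only [PiLp.inner_apply, ← Finset.sum_neg_distrib, Complex.inner]
  refine Finset.sum_congr rfl fun i _ => ?_
  simp
  ring

/-- The `2`-jet of a potential in a K-frame. -/
lemma jet_of_isBigO {φ : Cm m → ℝ} (hφ : ContDiffAt ℝ ∞ φ 0)
    (hO : (fun w => φ w - ‖w‖ ^ 2) =O[𝓝 0] fun w => ‖w‖ ^ 3) :
    fderiv ℝ φ 0 = 0 ∧ ∀ u v, fderiv ℝ (fderiv ℝ φ) 0 u (Complex.I • v)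
      = -fderiv ℝ (fderiv ℝ φ) 0 v (Complex.I • u) := by
  have hn : ContDiff ℝ ∞ fun w : Cm m => ‖w‖ ^ 2 := contDiff_norm_sq ℝ
  obtain ⟨-, h1, h2⟩ := fderiv_eq_zero_of_isBigO_cube (f := φ - fun w : Cm m => ‖w‖ ^ 2)
    (hφ.sub hn.contDiffAt) hO
  have e : fderiv ℝ (φ - fun w : Cm m => ‖w‖ ^ 2) =ᶠ[𝓝 0]
      fun w => fderiv ℝ φ w - (2 • innerSL ℝ) w := by
    filter_upwards [(hφ.of_le one_add_one_le_infty).eventually (by simp [one_add_one_eq_two])]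
      with w hw
    rw [fderiv_sub (hw.differentiableAt (by simp)) (hn.contDiffAt.differentiableAt (by simp)),
      fderiv_norm_sq_Cm]
  have h1' : fderiv ℝ φ 0 = 0 := by
    have := e.self_of_nhds
    rw [h1] at this
    simpa using this.symm
  refine ⟨h1', fun u v => ?_⟩
  rw [e.fderiv_eq] at h2
  have d1 : HasFDerivAt (fderiv ℝ φ) (fderiv ℝ (fderiv ℝ φ) 0) 0 :=
    ((hφ.fderiv_right (m := 1) one_add_one_le_infty).differentiableAt (by simp)).hasFDerivAt
  have d2 : HasFDerivAt (fun w : Cm m => (2 • innerSL ℝ : Cm m →L[ℝ] Cm m →L[ℝ] ℝ) w)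
      (2 • innerSL ℝ : Cm m →L[ℝ] Cm m →L[ℝ] ℝ) 0 := ContinuousLinearMap.hasFDerivAt _
  have h3 : fderiv ℝ (fderiv ℝ φ) 0 = (2 • innerSL ℝ : Cm m →L[ℝ] Cm m →L[ℝ] ℝ) := by
    have := (d1.sub d2).fderiv
    have h4 := h2.symm.trans this
    exact (sub_eq_zero.1 h4.symm)
  rw [h3]
  have := inner_I_smul_antisymm u v
  simp only [smul_apply]
  rw [this, smul_neg]

/-- If `γ` fixes the origin and `Θ` is a primitive of `Im (∂φ - γ^*∂φ)`, then `Θ` has vanishing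
derivatives of orders one and two at the origin. -/
lemma fderiv_phase_eq_zero {φ Θ : Cm m → ℝ} {γ : Cm m → Cm m} (hφ : ContDiffAt ℝ ∞ φ 0)
    (hγ : ContDiffAt ℝ ∞ γ 0) (hγ0 : γ 0 = 0) (hφ1 : fderiv ℝ φ 0 = 0)
    (hφ2 : ∀ u v, fderiv ℝ (fderiv ℝ φ) 0 u (Complex.I • v)
      = -fderiv ℝ (fderiv ℝ φ) 0 v (Complex.I • u))
    (hΘ : ∀ᶠ w in 𝓝 0, HasFDerivAt Θ (Complex.imCLM.comp (delPart (Cm m) (fderiv ℝ φ w)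
      - (delPart (Cm m) (fderiv ℝ φ (γ w))).comp (fderiv ℝ γ w))) w) :
    ContDiffAt ℝ ∞ Θ 0 ∧ fderiv ℝ Θ 0 = 0 ∧ fderiv ℝ (fderiv ℝ Θ) 0 = 0 := by
  set η : Cm m → Cm m →L[ℝ] ℂ := fun w => delPart (Cm m) (fderiv ℝ φ w)
      - (delPart (Cm m) (fderiv ℝ φ (γ w))).comp (fderiv ℝ γ w) with hη
  have hle : ∞ + 1 ≤ (∞ : WithTop ℕ∞) := le_rfl
  have hφγ : ContDiffAt ℝ ∞ φ (γ 0) := by rwa [hγ0]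
  have hηs : ContDiffAt ℝ ∞ η 0 := by
    have h1 : ContDiffAt ℝ ∞ (fun w => delPart (Cm m) (fderiv ℝ φ w)) 0 :=
      (delPart (Cm m)).contDiff.contDiffAt.comp _ (hφ.fderiv_right hle)
    have h2 : ContDiffAt ℝ ∞ (fun w => delPart (Cm m) (fderiv ℝ φ (γ w))) 0 :=
      (delPart (Cm m)).contDiff.contDiffAt.comp _
        (ContDiffAt.comp (g := fderiv ℝ φ) 0 (hφγ.fderiv_right hle) hγ)
    exact h1.sub (h2.clm_comp (hγ.fderiv_right hle))
  have hιs : ContDiffAt ℝ ∞ (fun w => Complex.imCLM.comp (η w)) 0 := contDiffAt_const.clm_comp hηs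
  have hΘs : ContDiffAt ℝ ∞ Θ 0 := by
    rw [contDiffAt_infty]
    intro n
    -- The derivative of `Θ` is smooth, so `Θ` has one derivative more, to every finite order.
    have : ContDiffAt ℝ (n + 1 : ℕ) Θ 0 := by
      push_cast
      rw [contDiffAt_succ_iff_hasFDerivAt]
      exact ⟨_, ⟨_, hΘ, fun _ hw => hw⟩, hιs.of_le (WithTop.coe_le_coe.2 le_top)⟩
    exact this.of_le (by exact_mod_cast Nat.le_succ n)
  have e : fderiv ℝ Θ =ᶠ[𝓝 0] fun w => Complex.imCLM.comp (η w) := hΘ.mono fun w hw => hw.fderiv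
  refine ⟨hΘs, ?_, ?_⟩
  · rw [e.self_of_nhds]
    simp only [hη, hγ0, hφ1, map_zero, ContinuousLinearMap.zero_comp, sub_zero,
      ContinuousLinearMap.comp_zero]
  set Q := fderiv ℝ (fderiv ℝ φ) 0 with hQdef
  set A := fderiv ℝ γ 0
  have dφ : HasFDerivAt (fderiv ℝ φ) Q 0 :=
    ((hφ.fderiv_right (m := 1) one_add_one_le_infty).differentiableAt (by simp)).hasFDerivAt
  have dφ' : HasFDerivAt (fderiv ℝ φ) Q (γ 0) := by rwa [hγ0]
  have dγ : HasFDerivAt γ A 0 := (hγ.differentiableAt (by simp)).hasFDerivAt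
  have dγ2 : HasFDerivAt (fderiv ℝ γ) (fderiv ℝ (fderiv ℝ γ) 0) 0 :=
    ((hγ.fderiv_right (m := 1) one_add_one_le_infty).differentiableAt (by simp)).hasFDerivAt
  have b1 : HasFDerivAt (fun w => delPart (Cm m) (fderiv ℝ φ w)) ((delPart (Cm m)).comp Q) 0 :=
    (delPart (Cm m)).hasFDerivAt.comp 0 dφ
  have b2 : HasFDerivAt (fun w => delPart (Cm m) (fderiv ℝ φ (γ w)))
      ((delPart (Cm m)).comp (Q.comp A)) 0 :=
    (delPart (Cm m)).hasFDerivAt.comp 0 (HasFDerivAt.comp (g := fderiv ℝ φ) 0 dφ' dγ)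
  have b3 := (hasFDerivAt_const Complex.imCLM (0 : Cm m)).clm_comp (b1.sub (b2.clm_comp dγ2))
  -- The term with `D²γ` is multiplied by `∂φ` at `γ 0 = 0`, which is zero; taking the imaginary
  -- part leaves only the `i`-rotated half of `delPart`.
  have key : ∀ u v, fderiv ℝ (fderiv ℝ Θ) 0 u v =
      -(1 / 2) * (Q u (Complex.I • v) - Q (A u) (Complex.I • A v)) := by
    intro u v
    rw [e.fderiv_eq]
    erw [b3.fderiv]
    have hA0 : fderiv ℝ φ (γ 0) = 0 := by rw [hγ0, hφ1]
    simp [hA0, delPart_apply]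
    ring
  have hsymm : ∀ u v, fderiv ℝ (fderiv ℝ Θ) 0 u v = fderiv ℝ (fderiv ℝ Θ) 0 v u :=
    (hΘs.of_le one_add_one_le_infty).isSymmSndFDerivAt (by simp [one_add_one_eq_two])
  ext u v
  -- The right side of `key` is alternating by `hφ2`, while the Hessian is symmetric.
  have h1 := hsymm u v
  rw [key u v, key v u, hφ2 u v, hφ2 (A u) (A v)] at h1
  rw [key u v, hφ2 u v, hφ2 (A u) (A v), zero_apply, zero_apply]
  linarith

/-- The second order expansion of `φ ∘ γ`. -/
lemma isBigO_potential_comp {φ : Cm m → ℝ} {γ : Cm m → Cm m} (hγ : ContDiffAt ℝ ∞ γ 0)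
    (hγ0 : γ 0 = 0) (hO : (fun w => φ w - ‖w‖ ^ 2) =O[𝓝 0] fun w => ‖w‖ ^ 3) :
    (fun w => φ (γ w) - ‖fderiv ℝ γ 0 w‖ ^ 2) =O[𝓝 0] fun w => ‖w‖ ^ 3 := by
  set A := fderiv ℝ γ 0
  have hγd : DifferentiableAt ℝ γ 0 := hγ.differentiableAt (by simp)
  have hγO : γ =O[𝓝 0] fun w => ‖w‖ := by
    simpa [hγ0] using hγd.isBigO_sub.norm_right
  have hAO : (fun w => A w) =O[𝓝 0] fun w => ‖w‖ := (A.isBigO_id _).norm_right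
  have hγt : Tendsto γ (𝓝 0) (𝓝 0) := by
    have := hγ.continuousAt.tendsto
    rwa [hγ0] at this
  have h1 : (fun w => φ (γ w) - ‖γ w‖ ^ 2) =O[𝓝 0] fun w => ‖w‖ ^ 3 :=
    (hO.comp_tendsto hγt).trans (hγO.norm_left.pow 3)
  have h2 : (fun w => γ w - A w) =O[𝓝 0] fun w => ‖w‖ ^ 2 := by
    have hd : ∀ᶠ w in 𝓝 (0 : Cm m), DifferentiableAt ℝ γ w :=
      ((hγ.of_le one_add_one_le_infty).eventually (by simp [one_add_one_eq_two])).mono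
        fun w hw => hw.differentiableAt (by simp)
    have hd2 : fderiv ℝ (fun w => γ w - A w) =O[𝓝 0] fun w => ‖w‖ ^ 1 := by
      have h3 : (fun w => fderiv ℝ γ w - A) =O[𝓝 0] fun w => ‖w‖ ^ 1 := by
        simpa using ((hγ.fderiv_right (m := 1) one_add_one_le_infty).differentiableAt
          (by simp)).isBigO_sub.norm_right
      refine h3.congr' ?_ EventuallyEq.rfl
      filter_upwards [hd] with w hw
      exact (hw.hasFDerivAt.sub A.hasFDerivAt).fderiv.symm
    simpa [hγ0] using isBigO_sub_of_isBigO_fderiv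
      (hd.mono fun w hw => hw.sub A.differentiableAt) hd2
  have h3 : (fun w => ‖γ w‖ - ‖A w‖) =O[𝓝 0] fun w => ‖w‖ ^ 2 :=
    IsBigO.trans (IsBigO.of_bound 1 (Eventually.of_forall fun w => by
      simpa using abs_norm_sub_norm_le (γ w) (A w))) h2
  -- Factor the difference of squares: one factor is quadratic, the other linear.
  have h4 : (fun w => ‖γ w‖ ^ 2 - ‖A w‖ ^ 2) =O[𝓝 0] fun w => ‖w‖ ^ 3 := by
    refine (h3.mul (hγO.norm_left.add hAO.norm_left)).congr (fun w => ?_) fun w => ?_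
    · ring
    · ring
  refine (h1.add h4).congr_left fun w => ?_
  ring

end Jets

/-! ### Real branches of an angle. -/

section Branches

/-- A nowhere vanishing function with logarithmic derivative `η` has locally a continuous branch of
its argument, which is a primitive of `Im η`. -/
lemma exists_hasFDerivAt_arg {E : Type*} [NormedAddCommGroup E] [NormedSpace ℝ E] {U : E → ℂ}
    {η : E → E →L[ℝ] ℂ} {x : E}
    (hU : ∀ᶠ w in 𝓝 x, U w ≠ 0 ∧ HasFDerivAt U (U w • η w) w) :
    ∃ Θ : E → ℝ, ∀ᶠ w in 𝓝 x, ((Θ w : ℝ) : Real.Angle) = (Complex.arg (U w) : Real.Angle) ∧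
      HasFDerivAt Θ (Complex.imCLM.comp (η w)) w := by
  obtain ⟨h0, hd⟩ := hU.self_of_nhds
  refine ⟨fun w => Complex.arg (U x) + (Complex.log ((U x)⁻¹ * U w)).im, ?_⟩
  have hcont : ContinuousAt (fun w => (U x)⁻¹ * U w) x := continuousAt_const.mul hd.continuousAt
  have hslit : ∀ᶠ w in 𝓝 x, (U x)⁻¹ * U w ∈ Complex.slitPlane :=
    hcont.eventually (Complex.isOpen_slitPlane.mem_nhds (by simp [inv_mul_cancel₀ h0]))
  filter_upwards [hU, hslit] with w ⟨hw, hdw⟩ hs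
  refine ⟨?_, ?_⟩
  · rw [Complex.log_im, Real.Angle.coe_add,
      ← Complex.arg_mul_coe_angle h0 (mul_ne_zero (inv_ne_zero h0) hw), mul_inv_cancel_left₀ h0]
  · have h1 : HasFDerivAt (fun w => Complex.log ((U x)⁻¹ * U w)) (η w) w := by
      refine ((Complex.hasStrictFDerivAt_log_real hs).hasFDerivAt.comp w
        (hdw.const_smul (U x)⁻¹)).congr_fderiv ?_
      ext v
      simp
      field_simp
    exact (Complex.imCLM.hasFDerivAt.comp w h1).const_add _

/-- The difference takes values in `2πℤ` and is continuous at `x`; near `x` it moves by less than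
`2π`, hence not at all. -/
lemma eventually_eq_add_const_of_angle_eq {X : Type*} [TopologicalSpace X] {f f' : X → ℝ} {x : X}
    (hf : ContinuousAt f x) (hf' : ContinuousAt f' x)
    (h : ∀ᶠ w in 𝓝 x, ((f w : ℝ) : Real.Angle) = (f' w : ℝ)) :
    ∀ᶠ w in 𝓝 x, f w = f' w + (f x - f' x) := by
  have hc := (hf.sub hf').eventually (Metric.ball_mem_nhds _ Real.two_pi_pos)
  obtain ⟨k₀, hk₀⟩ := Real.Angle.angle_eq_iff_two_pi_dvd_sub.1 h.self_of_nhds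
  filter_upwards [hc, h] with w hw hw'
  obtain ⟨k, hk⟩ := Real.Angle.angle_eq_iff_two_pi_dvd_sub.1 hw'
  simp only [Pi.sub_apply, Real.dist_eq, hk, hk₀, ← mul_sub, abs_mul,
    abs_of_pos Real.two_pi_pos] at hw
  have h1 : |(k : ℝ) - k₀| < 1 := by
    by_contra! h2
    nlinarith [Real.two_pi_pos]
  have h2 : k = k₀ := by
    rw [← sub_eq_zero, ← Int.abs_lt_one_iff]
    exact_mod_cast h1
  rw [hk₀, ← h2, ← hk]
  ring

end Branches

/-! ### The holonomy phase at a fixed point of `gᵀ`. -/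

section Holonomy

set_option linter.unusedSectionVars false

variable {m : ℕ} {M : Type*} [TopologicalSpace M] [ChartedSpace (Cm m) M]
  {L : M → Type*} [TopologicalSpace (Bundle.TotalSpace ℂ L)]
  [∀ x, NormedAddCommGroup (L x)] [∀ x, InnerProductSpace ℂ (L x)]
  [FiberBundle ℂ L] [VectorBundle ℂ ℂ L]

/-- Pairing with a normalized vector is a unit functional. A nonempty fibre is what lets two
branches of the phase be compared. -/
lemma CircleBundle.exists_base_eq {x : M} {v : L x} (hv : v ≠ 0) :
    ∃ p : CircleBundle L, p.base = x := by
  have h : ‖innerSL ℂ ((‖v‖⁻¹ : ℂ) • v)‖ = 1 := by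
    rw [innerSL_apply_norm, norm_smul, norm_inv, Complex.norm_real, norm_norm,
      inv_mul_cancel₀ (norm_ne_zero_iff.2 hv)]
  exact ⟨⟨⟨x, innerSL ℂ ((‖v‖⁻¹ : ℂ) • v)⟩, h⟩, rfl⟩

lemma fibreCoord_ne_zero {s : ∀ x, L x} {p : CircleBundle L} (hs : s p.base ≠ 0) :
    fibreCoord s p.1 ≠ 0 := by
  rw [← norm_ne_zero_iff, norm_fibreCoord s p.1 hs, p.2, one_mul]
  exact norm_ne_zero_iff.2 hs

lemma fibreAngle_sub {s : ∀ x, L x} {p q : CircleBundle L} {c : ℂ} (hc : c ≠ 0)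
    (hs : s p.base ≠ 0) (h : fibreCoord s q.1 = c * fibreCoord s p.1) :
    fibreAngle s q - fibreAngle s p = (Complex.arg c : Real.Angle) := by
  change ((Complex.arg (fibreCoord s q.1) : ℝ) : Real.Angle)
    - (Complex.arg (fibreCoord s p.1) : ℝ) = _
  rw [h, Complex.arg_mul_coe_angle hc (fibreCoord_ne_zero hs), add_sub_cancel_right]

/-- The potential of a K-frame agrees with `|w|²` to second order. -/
lemma IsKFrame.isBigO {κ : OpenPartialHomeomorph M (Cm m)} {e : ∀ x, L x} {N : ℕ} (hN : 2 ≤ N)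
    (he : IsKFrame κ e N) :
    (fun w => (potential e ∘ κ.symm) w - ‖w‖ ^ 2) =O[𝓝 0] fun w => ‖w‖ ^ 3 := by
  obtain ⟨-, -, P, hP, hO⟩ := he
  have h1 : (fun w : Cm m => MvPolynomial.eval
      (Sum.elim (fun j => w j) (fun j => (starRingEnd ℂ) (w j))) P) =O[𝓝 0] fun w => ‖w‖ ^ 3 := by
    refine isBigO_eval_mvPolynomial P (fun d hd => ?_) fun w i => ?_
    · rw [Fintype.sum_sum_type]
      have := hP d hd
      -- The monomials have degree at least four; three suffices.
      omega
    · rcases i with j | j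
      · exact PiLp.norm_apply_le w j
      · simpa using PiLp.norm_apply_le w j
  have h2 : (fun w : Cm m => ‖w‖ ^ (N + 1)) =O[𝓝 0] fun w => ‖w‖ ^ 3 := by
    refine IsBigO.of_bound 1 ?_
    filter_upwards [Metric.closedBall_mem_nhds (0 : Cm m) one_pos] with w hw
    have hw1 : ‖w‖ ≤ 1 := by simpa using hw
    rw [norm_pow, norm_pow, norm_norm, one_mul]
    exact pow_le_pow_of_le_one (norm_nonneg _) hw1 (by omega)
  have h3 := (hO.trans h2).add h1
  refine IsBigO.trans (IsBigO.of_bound 1 (Eventually.of_forall fun w => ?_)) h3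
  rw [one_mul, sub_add_cancel, ← Complex.ofReal_sub, Complex.norm_real]
  rfl

lemma IsKFrame.isHolomorphicFrameAt {κ : OpenPartialHomeomorph M (Cm m)} {e : ∀ x, L x} {N : ℕ}
    (he : IsKFrame κ e N) {x : M} (hx : x ∈ κ.source) : IsHolomorphicFrameAt m e x := by
  filter_upwards [κ.open_source.mem_nhds hx] with y hy
  exact ⟨he.1.contMDiffAt (κ.open_source.mem_nhds hy), he.2.1 y hy⟩

variable [T2Space M] [IsManifold 𝓘(ℂ, Cm m) ω M] [ContMDiffVectorBundle ω ℂ L 𝓘(ℂ, Cm m)]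
  {ξ : ∀ x : M, TangentSpace 𝓘(ℝ, Cm m) x} {g : Flow ℝ M}
  {H : M → ℝ} {G : Flow ℝ (CircleBundle L)} {κ : OpenPartialHomeomorph M (Cm m)}

lemma contDiffAt_potential_chart (hh : IsSmoothHermitianMetric (m := m) L)
    (hκ : κ ∈ IsManifold.maximalAtlas 𝓘(ℂ, Cm m) ω M) {e : ∀ x, L x} {w : Cm m}
    (hw : w ∈ κ.target) (he : IsHolomorphicFrameAt m e (κ.symm w)) :
    ContDiffAt ℝ ∞ (potential e ∘ κ.symm) w :=
  (ContMDiffAt.comp w (he.contMDiffAt_potential hh)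
    (contMDiffAt_real_symm_of_mem_maximalAtlas hκ hw)).contDiffAt

lemma contDiffAt_returnMap (hg : IsSmoothFlowOf ξ g)
    (hκ : κ ∈ IsManifold.maximalAtlas 𝓘(ℂ, Cm m) ω M) {T : ℝ} {w : Cm m} (hw : w ∈ κ.target)
    (hT : g T (κ.symm w) ∈ κ.source) : ContDiffAt ℝ ∞ (returnMap κ g T) w :=
  (ContMDiffAt.comp (g := κ) (f := fun w => g T (κ.symm w)) w
    (contMDiffAt_real_of_mem_maximalAtlas hκ hT)
    (contMDiffAt_flow_chart_right hg hκ T hw)).contDiffAt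

/-- Over a fixed point of `gᵀ`, the contact flow at time `T` multiplies the fibre coordinate by a
function with logarithmic derivative `∂φ - γ^*∂φ`, where `γ` is the first-return map. -/
lemma exists_hasFDerivAt_multiplier (hh : IsSmoothHermitianMetric (m := m) L)
    (hH : ContMDiff 𝓘(ℝ, Cm m) 𝓘(ℝ, ℝ) ∞ H) (hξ : IsHamiltonianVectorField L H ξ)
    (hg : IsSmoothFlowOf ξ g) (hG : IsContactFlow L H ξ G)
    (hκ : κ ∈ IsManifold.maximalAtlas 𝓘(ℂ, Cm m) ω M) (h0 : (0 : Cm m) ∈ κ.target)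
    {e : ∀ x, L x} (he : ∀ x ∈ κ.source, IsHolomorphicFrameAt m e x) {T : ℝ}
    (hT : g T (κ.symm 0) = κ.symm 0) :
    ∃ U : Cm m → ℂ, ∀ᶠ w in 𝓝 (0 : Cm m), U w ≠ 0 ∧
      (∀ p : CircleBundle L, p.base = κ.symm w →
        fibreCoord e (G T p).1 = U w * fibreCoord e p.1) ∧
      HasFDerivAt U (U w • (delPart (Cm m) (fderiv ℝ (potential e ∘ κ.symm) w)
        - (delPart (Cm m) (fderiv ℝ (potential e ∘ κ.symm) (returnMap κ g T w))).comp
          (fderiv ℝ (returnMap κ g T) w))) w := by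
  have hz : κ.symm 0 ∈ κ.source := κ.map_target h0
  obtain ⟨U, hU⟩ := hasTransport hh hH hξ hg hG hκ h0 (he _ hz) (t := T) (s := e)
    (by rw [hT]; exact he _ hz)
  refine ⟨U, ?_⟩
  have hcont : ContinuousAt (fun w => g T (κ.symm w)) 0 :=
    (contMDiffAt_flow_chart_right hg hκ T h0).continuousAt
  filter_upwards [hU, κ.open_target.mem_nhds h0,
    hcont.eventually (κ.open_source.mem_nhds (hT.symm ▸ hz :))] with w hw hwκ hwT
  refine ⟨hw.1, hw.2.1, ?_⟩
  have hws := κ.map_target hwκ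
  have e1 := pullDel_eq_chart (φ := potential e) hκ hws
    (((he _ hws).contMDiffAt_potential hh).mdifferentiableAt (by simp))
    ((contMDiffAt_real_symm_of_mem_maximalAtlas hκ hwκ).mdifferentiableAt (by simp))
  have e2 := pullDel_eq_chart (φ := potential e) (y := fun w => g T (κ.symm w)) hκ hwT
    (((he _ hwT).contMDiffAt_potential hh).mdifferentiableAt (by simp))
    ((contMDiffAt_flow_chart_right hg hκ T hwκ).mdifferentiableAt (by simp))
  have e3 : κ ∘ κ.symm =ᶠ[𝓝 w] id := κ.eventually_right_inverse hwκ
  rw [e3.fderiv_eq, fderiv_id, ContinuousLinearMap.comp_id, κ.right_inv hwκ] at e1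
  have h := hw.2.2
  rw [e1, e2] at h
  exact h

end Holonomy

end ContactHolonomy

end

theorem mainTheorem7 {m : ℕ} {M : Type*} [TopologicalSpace M] [T2Space M]
    [ChartedSpace (ContactHolonomy.Cm m) M]
    [IsManifold 𝓘(ℂ, ContactHolonomy.Cm m) ω M]
    (L : M → Type*) [TopologicalSpace (Bundle.TotalSpace ℂ L)]
    [∀ x, NormedAddCommGroup (L x)] [∀ x, InnerProductSpace ℂ (L x)]
    [FiberBundle ℂ L] [VectorBundle ℂ ℂ L]
    [ContMDiffVectorBundle ω ℂ L 𝓘(ℂ, ContactHolonomy.Cm m)]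
    (hh : ContactHolonomy.IsSmoothHermitianMetric (m := m) L)
    (hpos : ContactHolonomy.IsPositive (m := m) L)
    (H : M → ℝ) (hH : ContMDiff 𝓘(ℝ, ContactHolonomy.Cm m) 𝓘(ℝ, ℝ) ∞ H)
    (ξ : ∀ x : M, TangentSpace 𝓘(ℝ, ContactHolonomy.Cm m) x)
    (hξ : ContactHolonomy.IsHamiltonianVectorField L H ξ)
    (g : Flow ℝ M) (hg : ContactHolonomy.IsSmoothFlowOf ξ g)
    (G : Flow ℝ (ContactHolonomy.CircleBundle L)) (hG : ContactHolonomy.IsContactFlow L H ξ G)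
    (z : M) (T : ℝ) (hT : g T z = z)
    (κ : OpenPartialHomeomorph M (ContactHolonomy.Cm m))
    (hκ : ContactHolonomy.IsKCoordinates L z κ)
    (e : ∀ x, L x) (N : ℕ) (hN : 2 ≤ N) (he : ContactHolonomy.IsKFrame κ e N) :
    (∃ Θ : ContactHolonomy.Cm m → ℝ, ContactHolonomy.IsHolonomyPhase κ e G T Θ) ∧
    ∀ Θ : ContactHolonomy.Cm m → ℝ, ContactHolonomy.IsHolonomyPhase κ e G T Θ →
      ContDiffAt ℝ ∞ Θ 0 ∧
      ((fun w => Θ w - Θ 0) =O[𝓝 0] fun w => ‖w‖ ^ 3) ∧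
      fderiv ℝ (fderiv ℝ Θ) 0 = 0 ∧
      ((fun w =>
          (-Complex.I * Θ w
              - (1 / 2) * ContactHolonomy.potential e (κ.symm (ContactHolonomy.returnMap κ g T w)))
            - (-Complex.I * Θ 0
              - (1 / 2) * ‖fderiv ℝ (ContactHolonomy.returnMap κ g T) 0 w‖ ^ 2))
        =O[𝓝 0] fun w => ‖w‖ ^ 3) := by
  open ContactHolonomy in
  obtain ⟨hmax, hz, hκz, -⟩ := hκ
  have h0 : (0 : Cm m) ∈ κ.target := hκz ▸ κ.map_source hz
  have hz0 : κ.symm 0 = z := by rw [← hκz, κ.left_inv hz]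
  have hfr : ∀ x ∈ κ.source, IsHolomorphicFrameAt m e x := fun x hx => he.isHolomorphicFrameAt hx
  have hT0 : g T (κ.symm 0) = κ.symm 0 := by rw [hz0, hT]
  have hφ := contDiffAt_potential_chart hh hmax h0 (hfr _ (κ.map_target h0))
  have hγ : ContDiffAt ℝ ∞ (returnMap κ g T) 0 :=
    contDiffAt_returnMap hg hmax h0 (by rw [hT0, hz0]; exact hz)
  have hγ0 : returnMap κ g T 0 = 0 := by rw [returnMap, hT0, hz0, hκz]
  have hO := he.isBigO hN
  obtain ⟨hφ1, hφ2⟩ := jet_of_isBigO hφ hO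
  obtain ⟨U, hU⟩ := exists_hasFDerivAt_multiplier hh hH hξ hg hG hmax h0 hfr hT0
  obtain ⟨Θ₁, hΘ₁⟩ := exists_hasFDerivAt_arg (hU.mono fun w hw => ⟨hw.1, hw.2.2⟩)
  have hangle : ∀ᶠ w in 𝓝 (0 : Cm m), ∀ p : CircleBundle L, p.base = κ.symm w →
      fibreAngle e (G T p) - fibreAngle e p = ((Θ₁ w : ℝ) : Real.Angle) := by
    filter_upwards [hU, hΘ₁, κ.open_target.mem_nhds h0] with w hw hw₁ hwκ p hp
    rw [hw₁.1]
    exact fibreAngle_sub hw.1 (by rw [hp]; exact he.2.1 _ (κ.map_target hwκ)) (hw.2.1 p hp)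
  have hcont₁ : ContinuousAt Θ₁ 0 := hΘ₁.self_of_nhds.2.continuousAt
  refine ⟨⟨Θ₁, hcont₁, hangle⟩, fun Θ hΘ => ?_⟩
  -- Both branches represent the angle difference at any point of `X` over `κ.symm w`, so an
  -- arbitrary branch has the derivative of `Θ₁` near `0`.
  have heq : ∀ᶠ w in 𝓝 0, Θ w = Θ₁ w + (Θ 0 - Θ₁ 0) := by
    refine eventually_eq_add_const_of_angle_eq hΘ.1 hcont₁ ?_
    filter_upwards [hΘ.2, hangle, κ.open_target.mem_nhds h0] with w hw hw₁ hwκ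
    obtain ⟨p, hp⟩ := CircleBundle.exists_base_eq (he.2.1 _ (κ.map_target hwκ))
    rw [← hw p hp, hw₁ p hp]
  obtain ⟨hs, hd1, hd2⟩ := fderiv_phase_eq_zero (Θ := Θ) hφ hγ hγ0 hφ1 hφ2 (by
    filter_upwards [hΘ₁, heq.eventually_nhds] with w hw hw'
    exact (hw.2.add_const _).congr_of_eventuallyEq hw')
  have hcube := isBigO_cube_of_fderiv_eq_zero hs hd1 hd2
  refine ⟨hs, hcube, hd2, ?_⟩
  have hpot := isBigO_potential_comp hγ hγ0 hO
  have hc1 := (Complex.isBigO_ofReal_left.2 hcube).const_mul_left (-Complex.I)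
  have hc2 := (Complex.isBigO_ofReal_left.2 hpot).const_mul_left (1 / 2)
  refine (hc1.sub hc2).congr_left fun w => ?_
  simp only [Function.comp_apply]
  push_cast
  ring
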